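/- Fix an integer $r\ge 2$ and write $\zeta_{2r}^x=e^{\pi\sqrt{-1}\,x/r}$ for $x\in\mathbb C$. For $\alpha\in\mathbb C$ let $V_\alpha$ be the $r$-dimensional highest weight module, with basis $v_0,\dots,v_{r-1}$, of the unrolled restricted quantum group $\overline U{}^H_{\zeta_{2r}}(\mathfrak{sl}_2)$: $$Hv_i=(\alpha-2i)v_i,\quad Kv_i=\zeta_{2r}^{\alpha-2i}v_i,\quad Ev_i=\tfrac{\zeta_{2r}^{\alpha-i+1}-\zeta_{2r}^{-(\alpha-i+1)}}{\zeta_{2r}-\zeta_{2r}^{-1}}v_{i-1},\quad Fv_i=\tfrac{\zeta_{2r}^{i+1}-\zeta_{2r}^{-(i+1)}}{\zeta_{2r}-\zeta_{2r}^{-1}}v_{i+1}\qquad(v_{-1}=v_r=0).$$ Let $L$ be a framed oriented link in $S^3$ with $n\geq 1$ components, coloured by $V_{\alpha_1},\dots,V_{\alpha_n}$. Cut $L$ open along any one component $c$ to a $(1,1)$-tangle $T$, given by any diagram whose blackboard framing is the framing of $L$ and all of whose crossings have both strands oriented downwards. Let $F(T)\in\operatorname{End}(V_{\alpha_c})$ be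 the value of the Reshetikhin-Turaev functor, in which positive crossings are sent to the braiding $\tau\circ R$ and negative crossings to the inverse braiding $R^{-1}\circ\tau$, where $\tau$ is the flip and $$R=\zeta_{2r}^{H\otimes H/2}\sum_{k=0}^{r-1}\frac{(\zeta_{2r}-\zeta_{2r}^{-1})^{2k}}{\zeta_{2r}^k\,(\zeta_{2r}^{-2};\zeta_{2r}^{-2})_k}E^k\otimes F^k ,\qquad (x;p)_k=\prod_{m=0}^{k-1}(1-xp^m),$$ and the cups and caps are sent to $1\mapsto\sum v_i\otimes v_i^*$, $1\mapsto \sum v_i^*\otimes K^{r-1}v_i$, $f\otimes v\mapsto f(v)$, $v\otimes f\mapsto f(K^{1-r}v)$. For $\alpha\in(\mathbb C\setminus\mathbb Z)^n$ one has $F(T)=\langle T\rangle\,\mathrm{Id}$ for a scalar $\langle T\rangle$, and the ADO invariant $N_L^r:(\mathbb C\setminus\mathbb Z)^n\to\mathbb C$ is $$N_L^r(\alpha_1,\dots,\alpha_n)=\langle T\rangle\prod_{j=0}^{r-2}\frac{1}{\zeta_{2r}^{\alpha_c+r-j}-\zeta_{2r}^{-(\alpha_c+r-j)}} .$$ Let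 $C=(C_{ij})$ be the linking matrix of $L$, with $C_{ii}$ the framing of the $i$-th component. Then: (i) If $n=1$, $N_L^r$ extends to a meromorphic function on $\mathbb C$ that is holomorphic on $\mathbb C\setminus\mathbb Z$ and has at most a simple pole at each integer. (ii) If $n>1$, $N_L^r$ extends to a holomorphic function on $\mathbb C^n$. (iii) For every $n$, every $i$ and every $\alpha\in(\mathbb C\setminus\mathbb Z)^n$, $$N_L^r(\alpha_1,\dots,\alpha_i+2r,\dots,\alpha_n)=\Big(\prod_{j=1}^n\zeta_{2r}^{2rC_{ij}\alpha_j}\Big)N_L^r(\alpha_1,\dots,\alpha_n).$$ Consequently $N_L^r$ is a section, holomorphic if $n>1$ and meromorphic if $n=1$, of the complex line bundle on $(\mathbb C/2r\mathbb Z)^n$ determined by $C$, namely the quotient of $\mathbb C^n\times\mathbb C$ by the action $m\cdot(\alpha,v)=\big(\alpha+2rm,\ \zeta_{2r}^{2r\sum_{i,j}m_iC_{ij}\alpha_j}v\big)$ of $\mathbb Z^n$. -/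

import Mathlib

noncomputable section

namespace ADO

/-! ### Oriented tangle diagrams

Diagrams are read from bottom to top and cut into elementary horizontal layers. The strands
crossing a horizontal line are listed from left to right. Every strand carries the index of the
link component to which it belongs. -/

/-- A strand crossing a horizontal line: its component and its orientation. -/
inductive Strand (n : ℕ) : Type
  | down (i : Fin n) : Strand n
  | up (i : Fin n) : Strand n

open Strand

/-- The component of a strand. -/
def Strand.comp {n : ℕ} : Strand n → Fin n
  | down i => i
  | up i => i

/-- An elementary layer of an oriented tangle diagram, from the list of strands below it to the
list of strands above it. It contains exactly one crossing (between two strands oriented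
downwards), cup or cap; all other strands are vertical.

* `pos i j w`: the positive crossing; the over-strand runs between bottom left and top right,
  and belongs to the component `i`.
* `neg i j w`: the negative crossing; the over-strand runs between bottom right and top left,
  and belongs to the component `j`.
* `cupR`, `cupL`: cups directed to the right and to the left.
* `capR`, `capL`: caps directed to the right and to the left.
* `skip x s`: the layer `s` with one more vertical strand `x` at its left.

The list `w` holds the vertical strands at the right. -/
inductive Layer (n : ℕ) : List (Strand n) → List (Strand n) → Type
  | pos (i j : Fin n) (w : List (Strand n)) :
      Layer n (down i :: down j :: w) (down j :: down i :: w)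
  | neg (i j : Fin n) (w : List (Strand n)) :
      Layer n (down i :: down j :: w) (down j :: down i :: w)
  | cupR (i : Fin n) (w : List (Strand n)) : Layer n w (down i :: up i :: w)
  | cupL (i : Fin n) (w : List (Strand n)) : Layer n w (up i :: down i :: w)
  | capR (i : Fin n) (w : List (Strand n)) : Layer n (up i :: down i :: w) w
  | capL (i : Fin n) (w : List (Strand n)) : Layer n (down i :: up i :: w) w
  | skip (x : Strand n) {v w : List (Strand n)} (s : Layer n v w) : Layer n (x :: v) (x :: w)

/-- A tangle diagram: a finite stack of layers, the lowest one first. -/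
inductive Diagram (n : ℕ) : List (Strand n) → List (Strand n) → Type
  | nil (v : List (Strand n)) : Diagram n v v
  | cons {u v w : List (Strand n)} (s : Layer n u v) (D : Diagram n v w) : Diagram n u w

/-! ### Components -/

/-- Two points on the boundary of a layer are joined by an arc inside the layer. The point
`Sum.inl p` is the `p`-th point from the left on the lower line, `Sum.inr p` the one on the upper
line. -/
inductive Layer.Joined {n : ℕ} :
    {v w : List (Strand n)} → Layer n v w → ℕ ⊕ ℕ → ℕ ⊕ ℕ → Prop
  | pos_left (i j w) : Joined (.pos i j w) (.inl 0) (.inr 1)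
  | pos_right (i j w) : Joined (.pos i j w) (.inl 1) (.inr 0)
  | pos_rest (i j w p) : Joined (.pos i j w) (.inl (p + 2)) (.inr (p + 2))
  | neg_left (i j w) : Joined (.neg i j w) (.inl 0) (.inr 1)
  | neg_right (i j w) : Joined (.neg i j w) (.inl 1) (.inr 0)
  | neg_rest (i j w p) : Joined (.neg i j w) (.inl (p + 2)) (.inr (p + 2))
  | cupR (i w) : Joined (.cupR i w) (.inr 0) (.inr 1)
  | cupR_rest (i w p) : Joined (.cupR i w) (.inl p) (.inr (p + 2))
  | cupL (i w) : Joined (.cupL i w) (.inr 0) (.inr 1)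
  | cupL_rest (i w p) : Joined (.cupL i w) (.inl p) (.inr (p + 2))
  | capR (i w) : Joined (.capR i w) (.inl 0) (.inl 1)
  | capR_rest (i w p) : Joined (.capR i w) (.inl (p + 2)) (.inr p)
  | capL (i w) : Joined (.capL i w) (.inl 0) (.inl 1)
  | capL_rest (i w p) : Joined (.capL i w) (.inl (p + 2)) (.inr p)
  | skip_left (x) {v w} (s : Layer n v w) : Joined (.skip x s) (.inl 0) (.inr 0)
  | skip_rest (x) {v w} (s : Layer n v w) {a b : ℕ ⊕ ℕ} (h : Joined s a b) :
      Joined (.skip x s) (a.map Nat.succ Nat.succ) (b.map Nat.succ Nat.succ)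

/-- The horizontal lines of a diagram, from bottom to top. -/
def Diagram.lines {n : ℕ} : {v w : List (Strand n)} → Diagram n v w → List (List (Strand n))
  | _, _, .nil v => [v]
  | _, _, .cons (u := u) _ D => u :: D.lines

/-- The component at the point `(k, p)` of a diagram, the `p`-th point from the left on the `k`-th
horizontal line; `none` if there is no such point. -/
def Diagram.compAt {n : ℕ} {v w : List (Strand n)} (D : Diagram n v w) (x : ℕ × ℕ) :
    Option (Fin n) :=
  ((D.lines[x.1]?).bind fun l => l[x.2]?).map Strand.comp

/-- Two points of a diagram are joined by an arc inside one layer. -/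
inductive Diagram.Joined {n : ℕ} :
    {v w : List (Strand n)} → Diagram n v w → ℕ × ℕ → ℕ × ℕ → Prop
  | head {u v w : List (Strand n)} (s : Layer n u v) (D : Diagram n v w) {a b : ℕ ⊕ ℕ}
      (h : s.Joined a b) :
      Joined (.cons s D) (a.elim (Prod.mk 0) (Prod.mk 1)) (b.elim (Prod.mk 0) (Prod.mk 1))
  | tail {u v w : List (Strand n)} (s : Layer n u v) (D : Diagram n v w) {k l p q : ℕ}
      (h : Joined D (k, p) (l, q)) : Joined (.cons s D) (k + 1, p) (l + 1, q)

/-- The indices in `Fin n` number the connected components of the curve drawn by the diagram: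
each index occurs, and points with the same index are connected along the curve. (Connected points
always have the same index.) -/
def Diagram.NumbersComponents {n : ℕ} {v w : List (Strand n)} (D : Diagram n v w) : Prop :=
  (∀ i, ∃ x, D.compAt x = some i) ∧
    ∀ i x y, D.compAt x = some i → D.compAt y = some i → Relation.EqvGen D.Joined x y

/-! ### The linking matrix -/

/-- The signed number of crossings of a layer at which `i` passes over `j`. -/
def Layer.over {n : ℕ} : {v w : List (Strand n)} → Layer n v w → Fin n → Fin n → ℤ
  | _, _, .pos a b _, i, j => if i = a ∧ j = b then 1 else 0
  | _, _, .neg a b _, i, j => if i = b ∧ j = a then -1 else 0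
  | _, _, .skip _ s, i, j => s.over i j
  | _, _, .cupR _ _, _, _ => 0
  | _, _, .cupL _ _, _, _ => 0
  | _, _, .capR _ _, _, _ => 0
  | _, _, .capL _ _, _, _ => 0

/-- The linking matrix of a diagram. The entry `(i, j)` is the signed number of crossings at which
the component `i` passes over the component `j`. For `i ≠ j` this is the linking number (see
`linking_comm`); the entry `(i, i)` is the writhe of the component `i`, that is, its framing when
the link carries the blackboard framing. -/
def Diagram.linking {n : ℕ} : {v w : List (Strand n)} → Diagram n v w → Matrix (Fin n) (Fin n) ℤ
  | _, _, .nil _ => 0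
  | _, _, .cons s D => Matrix.of s.over + D.linking

/-- The algebraic number of strands of the component `i` on a horizontal line. -/
def Strand.sign {n : ℕ} (i : Fin n) : Strand n → ℤ
  | down a => if i = a then 1 else 0
  | up a => if i = a then -1 else 0

/-- The algebraic number of pairs on a horizontal line with `i` to the left of `j`. -/
def pairs {n : ℕ} (i j : Fin n) : List (Strand n) → ℤ
  | [] => 0
  | x :: w => x.sign i * (w.map (Strand.sign j)).sum + pairs i j w

theorem Layer.sum_sign {n : ℕ} (j : Fin n) {v w : List (Strand n)} (s : Layer n v w) :
    (v.map (Strand.sign j)).sum = (w.map (Strand.sign j)).sum := by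
  induction s with
  | skip x s ih => simp [ih]
  | _ => simp only [List.map_cons, List.sum_cons, Strand.sign]; split_ifs <;> ring

theorem Layer.pairs_eq {n : ℕ} {i j : Fin n} (hij : i ≠ j) {v w : List (Strand n)}
    (s : Layer n v w) : pairs i j v = pairs i j w + (s.over i j - s.over j i) := by
  induction s with
  | skip x s ih => simp only [pairs, Layer.over, ih, s.sum_sign j]; ring
  | _ => simp only [pairs, Layer.over, Strand.sign, List.map_cons, List.sum_cons]
         grind

theorem Diagram.pairs_eq {n : ℕ} {i j : Fin n} (hij : i ≠ j) {v w : List (Strand n)}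
    (D : Diagram n v w) : pairs i j v = pairs i j w + (D.linking i j - D.linking j i) := by
  induction D with
  | nil v => simp [Diagram.linking]
  | cons s D ih =>
    rw [s.pairs_eq hij, ih]
    simp only [Diagram.linking, Matrix.add_apply, Matrix.of_apply]
    ring

/-- The linking matrix of a diagram of a (1,1)-tangle is symmetric. -/
theorem Diagram.linking_comm {n : ℕ} {c : Fin n} (T : Diagram n [down c] [down c]) (i j : Fin n) :
    T.linking i j = T.linking j i := by
  rcases eq_or_ne i j with rfl | hij
  · rfl
  · have := T.pairs_eq hij
    linarith

/-! ### The modules `V_α` and the ribbon structure -/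

/-- `ζ_{2r}^x = exp (π √-1 x / r)`. -/
def zeta (r : ℕ) (x : ℂ) : ℂ := Complex.exp (Real.pi * Complex.I / r * x)

/-- The weight `α - 2 i` of the basis vector `v_i` of `V_α`. -/
def weight {r : ℕ} (α : ℂ) (i : Fin r) : ℂ := α - 2 * (i : ℕ)

/-- The action of `E` on `V_α` in the basis `v_0, …, v_{r-1}`. -/
def opE (r : ℕ) (α : ℂ) : Matrix (Fin r) (Fin r) ℂ := Matrix.of fun k i =>
  if (k : ℕ) + 1 = i then
    (zeta r (α - (i : ℕ) + 1) - zeta r (-(α - (i : ℕ) + 1))) / (zeta r 1 - zeta r (-1))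
  else 0

/-- The action of `F` on `V_α` in the basis `v_0, …, v_{r-1}`; it does not depend on `α`. -/
def opF (r : ℕ) : Matrix (Fin r) (Fin r) ℂ := Matrix.of fun k i =>
  if (k : ℕ) = i + 1 then
    (zeta r ((i : ℕ) + 1) - zeta r (-((i : ℕ) + 1))) / (zeta r 1 - zeta r (-1))
  else 0

/-- The `q`-Pochhammer symbol `(x; p)_k`. -/
def qPochhammer (x p : ℂ) (k : ℕ) : ℂ := ∏ m ∈ Finset.range k, (1 - x * p ^ m)

/-- The operator `ζ_{2r}^{s H ⊗ H / 2}` on `V_α ⊗ V_β`. -/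
def opHH (r : ℕ) (s α β : ℂ) : Matrix (Fin r × Fin r) (Fin r × Fin r) ℂ :=
  Matrix.diagonal fun p => zeta r (s * (weight α p.1 * weight β p.2 / 2))

open scoped Kronecker in
/-- The truncated `R`-matrix on `V_α ⊗ V_β`. -/
def opR (r : ℕ) (α β : ℂ) : Matrix (Fin r × Fin r) (Fin r × Fin r) ℂ :=
  opHH r 1 α β * ∑ k ∈ Finset.range r,
    ((zeta r 1 - zeta r (-1)) ^ (2 * k) /
      (zeta r k * qPochhammer (zeta r (-2)) (zeta r (-2)) k)) • ((opE r α ^ k) ⊗ₖ (opF r ^ k))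

open scoped Kronecker in
/-- The inverse of the truncated `R`-matrix on `V_α ⊗ V_β`. -/
def opRInv (r : ℕ) (α β : ℂ) : Matrix (Fin r × Fin r) (Fin r × Fin r) ℂ :=
  (∑ k ∈ Finset.range r,
    ((-1) ^ k * (zeta r 1 - zeta r (-1)) ^ (2 * k) /
      (zeta r ((k : ℂ) ^ 2) * qPochhammer (zeta r (-2)) (zeta r (-2)) k)) •
        ((opE r α ^ k) ⊗ₖ (opF r ^ k))) * opHH r (-1) α β

/-- The braiding `τ ∘ R : V_α ⊗ V_β → V_β ⊗ V_α`. -/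
def braiding (r : ℕ) (α β : ℂ) : Matrix (Fin r × Fin r) (Fin r × Fin r) ℂ :=
  (opR r α β).submatrix Prod.swap id

/-- The inverse braiding `R⁻¹ ∘ τ : V_α ⊗ V_β → V_β ⊗ V_α`, the inverse of
`τ ∘ R : V_β ⊗ V_α → V_α ⊗ V_β`. -/
def braidingInv (r : ℕ) (α β : ℂ) : Matrix (Fin r × Fin r) (Fin r × Fin r) ℂ :=
  (opRInv r β α).submatrix id Prod.swap

/-- The eigenvalue of `K ^ s` at the basis vector `v_i` of `V_α`. -/
def eigK (r : ℕ) (α s : ℂ) (i : Fin r) : ℂ := zeta r (s * weight α i)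

/-! ### The Reshetikhin-Turaev functor -/

/-- The index set of the standard basis of the tensor product attached to a list of strands: the
module `V_{α_i}` for a strand `down i`, with the basis `v_a`, and its dual for a strand `up i`,
with the dual basis. -/
def State {n : ℕ} (r : ℕ) : List (Strand n) → Type
  | [] => Unit
  | _ :: w => Fin r × State r w

instance State.instFintype {n r : ℕ} : (w : List (Strand n)) → Fintype (State r w)
  | [] => inferInstanceAs (Fintype Unit)
  | _ :: w =>
    haveI := State.instFintype (r := r) w
    inferInstanceAs (Fintype (Fin r × State r w))

instance State.instDecidableEq {n r : ℕ} : (w : List (Strand n)) → DecidableEq (State r w)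
  | [] => inferInstanceAs (DecidableEq Unit)
  | _ :: w =>
    haveI := State.instDecidableEq (r := r) w
    inferInstanceAs (DecidableEq (Fin r × State r w))

/-- The matrix of the linear map attached to a layer, when the component `i` is coloured by
`V_{α_i}`. The row index is the state above the layer, the column index the one below. The four
maps at cups and caps are

* `1 ↦ ∑ v_a ⊗ v_a^*` and `1 ↦ ∑ v_a^* ⊗ K^{r-1} v_a`,
* `f ⊗ v ↦ f v` and `v ⊗ f ↦ f (K^{1-r} v)`. -/
def Layer.matrix {n : ℕ} (r : ℕ) (α : Fin n → ℂ) :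
    {v w : List (Strand n)} → Layer n v w → Matrix (State r w) (State r v) ℂ
  | _, _, .pos i j _ => Matrix.of fun (b', a', t) (a, b, s) =>
      if t = s then braiding r (α i) (α j) (b', a') (a, b) else 0
  | _, _, .neg i j _ => Matrix.of fun (b', a', t) (a, b, s) =>
      if t = s then braidingInv r (α i) (α j) (b', a') (a, b) else 0
  | _, _, .cupR _ _ => Matrix.of fun (a, b, t) s => if t = s ∧ a = b then 1 else 0
  | _, _, .cupL i _ => Matrix.of fun (a, b, t) s =>
      if t = s ∧ a = b then eigK r (α i) (r - 1) b else 0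
  | _, _, .capR _ _ => Matrix.of fun t (a, b, s) => if t = s ∧ a = b then 1 else 0
  | _, _, .capL i _ => Matrix.of fun t (a, b, s) =>
      if t = s ∧ a = b then eigK r (α i) (1 - r) a else 0
  | _, _, .skip _ s => Matrix.of fun (a', t') (a, t) => if a' = a then s.matrix r α t' t else 0

/-- The linear map `F(D)` attached to a diagram, as a matrix. -/
def Diagram.matrix {n : ℕ} (r : ℕ) (α : Fin n → ℂ) :
    {v w : List (Strand n)} → Diagram n v w → Matrix (State r w) (State r v) ℂ
  | _, _, .nil _ => 1
  | _, _, .cons s D => D.matrix r α * s.matrix r α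

/-! ### The ADO invariant -/

open Classical in
/-- The scalar `⟨T⟩` of a (1,1)-tangle, with `F(T) = ⟨T⟩ • Id`. -/
def Diagram.bracket {n : ℕ} (r : ℕ) {c : Fin n} (T : Diagram n [down c] [down c])
    (α : Fin n → ℂ) : ℂ :=
  if h : ∃ z : ℂ, T.matrix r α = z • 1 then h.choose else 0

/-- The modified dimension of `V_α`. -/
def modifiedDim (r : ℕ) (α : ℂ) : ℂ :=
  ∏ j ∈ Finset.range (r - 1), 1 / (zeta r (α + r - j) - zeta r (-(α + r - j)))

/-- The ADO invariant `N_L^r (α_1, …, α_n)` of the framed oriented link `L` obtained as the closure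
of the (1,1)-tangle `T`, whose open component is `c`. -/
def Diagram.invariant {n : ℕ} (r : ℕ) {c : Fin n} (T : Diagram n [down c] [down c])
    (α : Fin n → ℂ) : ℂ :=
  modifiedDim r (α c) * T.bracket r α

/-- The integers, as a subset of `ℂ`. -/
def integers : Set ℂ := Set.range ((↑) : ℤ → ℂ)

/-! ### The line bundle of an integral matrix -/

/-- The complex manifold `(ℂ / 2rℤ)^n`. -/
abbrev Base (r n : ℕ) : Type := Fin n → AddCircle (2 * (r : ℂ))

/-- The covering `ℂ^n → (ℂ / 2rℤ)^n`. -/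
def cover (r n : ℕ) (α : Fin n → ℂ) : Base r n := fun i => (α i : AddCircle (2 * (r : ℂ)))

theorem cover_surjective (r n : ℕ) : Function.Surjective (cover r n) := fun x =>
  ⟨fun i => (x i).out, funext fun i => Quotient.out_eq' (x i)⟩

theorem cover_isLocalHomeomorph (r n : ℕ) : IsLocalHomeomorph (cover r n) := by
  have h := AddCircle.isLocalHomeomorph_coe (2 * (r : ℂ))
  refine IsLocalHomeomorph.mk _ fun α => ?_
  choose e he using fun i => h (α i)
  refine ⟨OpenPartialHomeomorph.pi e, fun i _ => (he i).1, fun β _ => ?_⟩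
  funext i
  exact congrFun (he i).2 (β i)

theorem exists_int_of_cover_eq {r n : ℕ} {α β : Fin n → ℂ} (h : cover r n α = cover r n β) :
    ∃ m : Fin n → ℤ, ∀ i, β i - α i = m i * (2 * (r : ℂ)) := by
  choose m hm using fun i => AddSubgroup.mem_zmultiples_iff.1
    (QuotientAddGroup.eq.1 (congrFun h i))
  exact ⟨m, fun i => by rw [← zsmul_eq_mul, hm i]; ring⟩

/-- A chart of `(ℂ / 2rℤ)^n` near the image of `p`: a local inverse of the covering. -/
def chart {r n : ℕ} (p : Fin n → ℂ) : OpenPartialHomeomorph (Base r n) (Fin n → ℂ) :=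
  (cover_isLocalHomeomorph r n).localInverseAt p

/-- The factor `ζ_{2r}^{∑_{ij} (β_i - α_i) C_{ij} α_j}` by which a quasi-periodic function changes
from `α` to a point `β` over the same point of `(ℂ / 2rℤ)^n`. -/
def factor (r : ℕ) {n : ℕ} (C : Matrix (Fin n) (Fin n) ℤ) (α β : Fin n → ℂ) : ℂ :=
  zeta r (∑ i, ∑ j, (β i - α i) * C i j * α j)

theorem factor_self (r : ℕ) {n : ℕ} (C : Matrix (Fin n) (Fin n) ℤ) (α : Fin n → ℂ) :
    factor r C α α = 1 := by
  simp [factor, zeta]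

theorem factor_mul (r : ℕ) {n : ℕ} (C : Matrix (Fin n) (Fin n) ℤ) {α β γ : Fin n → ℂ}
    (h₁ : cover r n α = cover r n β) (h₂ : cover r n β = cover r n γ) :
    factor r C β γ * factor r C α β = factor r C α γ := by
  obtain ⟨a, ha⟩ := exists_int_of_cover_eq h₁
  obtain ⟨b, hb⟩ := exists_int_of_cover_eq h₂
  have e : (∑ i, ∑ j, (γ i - β i) * C i j * β j) + (∑ i, ∑ j, (β i - α i) * C i j * α j)
      = (∑ i, ∑ j, (γ i - α i) * C i j * α j)
        + ((∑ i, ∑ j, b i * C i j * a j : ℤ) : ℂ) * (4 * (r : ℂ) ^ 2) := by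
    push_cast
    simp only [Finset.sum_mul, ← Finset.sum_add_distrib]
    refine Finset.sum_congr rfl fun i _ => Finset.sum_congr rfl fun j _ => ?_
    have h1 : γ i = β i + b i * (2 * (r : ℂ)) := by linear_combination hb i
    have h2 : β j = α j + a j * (2 * (r : ℂ)) := by linear_combination ha j
    rw [h1, h2]
    ring
  rw [factor, factor, factor, zeta, zeta, zeta, ← Complex.exp_add, ← mul_add, e, mul_add,
    Complex.exp_add]
  set k : ℤ := ∑ i, ∑ j, b i * C i j * a j
  have : (Real.pi * Complex.I / r * ((k : ℂ) * (4 * (r : ℂ) ^ 2)))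
      = ((k * (2 * r) : ℤ) : ℂ) * (2 * Real.pi * Complex.I) := by
    rcases eq_or_ne (r : ℂ) 0 with h | h
    · simp [h]
    · push_cast
      field_simp
      ring
  rw [this, Complex.exp_int_mul_two_pi_mul_I, mul_one]

/-- The complex line bundle on `(ℂ / 2rℤ)^n` determined by the integral matrix `C`. It has one local
trivialization for each point `p` of `ℂ^n`, over the domain of the chart at `p`; in terms of the
points `α`, `β` of two such charts over the same point of the base, the change of coordinates is
multiplication by `ζ_{2r}^{∑_{ij} (β_i - α_i) C_{ij} α_j}`. In other words, it is the quotient of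
`ℂ^n × ℂ` by the action `m • (α, v) = (α + 2 r m, ζ_{2r}^{2r ∑_{ij} m_i C_{ij} α_j} v)` of
`ℤ^n`. -/
def lineBundle (r : ℕ) {n : ℕ} (C : Matrix (Fin n) (Fin n) ℤ) :
    VectorBundleCore ℂ (Base r n) ℂ (Fin n → ℂ) where
  baseSet p := (chart p).source
  isOpen_baseSet p := (chart p).open_source
  indexAt x := (cover_surjective r n x).choose
  mem_baseSet_at x := by
    have h := (cover_isLocalHomeomorph r n).apply_self_mem_localInverseAt_source
      (x := (cover_surjective r n x).choose)
    rwa [(cover_surjective r n x).choose_spec] at h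
  coordChange p q x := factor r C (chart p x) (chart q x) • ContinuousLinearMap.id ℂ ℂ
  coordChange_self p x _ v := by simp [factor_self]
  continuousOn_coordChange p q := by
    refine ContinuousOn.smul
      (f := fun x : Base r n => factor r C (chart p x) (chart q x)) ?_ continuousOn_const
    have hp : ContinuousOn (chart (r := r) p) ((chart p).source ∩ (chart q).source) :=
      (chart p).continuousOn.mono Set.inter_subset_left
    have hq : ContinuousOn (chart (r := r) q) ((chart p).source ∩ (chart q).source) :=
      (chart q).continuousOn.mono Set.inter_subset_right
    have hp' := continuousOn_pi.1 hp
    have hq' := continuousOn_pi.1 hq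
    unfold factor zeta
    fun_prop
  coordChange_comp p q s x hx v := by
    have h : ∀ t : Fin n → ℂ, x ∈ (chart t).source → cover r n (chart t x) = x := fun t ht =>
      (cover_isLocalHomeomorph r n).apply_localInverseAt_of_mem ht
    have h₁ := h p hx.1.1
    have h₂ := h q hx.1.2
    have h₃ := h s hx.2
    simp only [smul_apply, ContinuousLinearMap.id_apply, smul_eq_mul]
    rw [← factor_mul r C (h₁.trans h₂.symm) (h₂.trans h₃.symm)]
    ring

/-- The changes of coordinates of the line bundle are holomorphic. -/
theorem factor_differentiableOn (r : ℕ) {n : ℕ} (C : Matrix (Fin n) (Fin n) ℤ) (q : Fin n → ℂ) :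
    DifferentiableOn ℂ (fun α => factor r C α (chart q (cover r n α)))
      (cover r n ⁻¹' (chart q).source) := by
  intro α₀ h₀
  have hl := cover_isLocalHomeomorph r n
  have hopen : IsOpen (cover r n ⁻¹' (chart q).source) :=
    (chart q).open_source.preimage hl.continuous
  have hint : ∀ α ∈ cover r n ⁻¹' (chart (r := r) q).source,
      ∃ m : Fin n → ℤ, ∀ i, chart q (cover r n α) i - α i = m i * (2 * (r : ℂ)) := fun α hα =>
    exists_int_of_cover_eq (hl.apply_localInverseAt_of_mem hα).symm
  have hc : ContinuousAt (fun α => chart q (cover r n α) - α) α₀ :=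
    (ContinuousAt.comp (f := cover r n) ((chart q).continuousAt h₀)
      hl.continuous.continuousAt).sub continuousAt_id
  have hloc : ∀ᶠ α in nhds α₀,
      chart q (cover r n α) = α + (chart q (cover r n α₀) - α₀) := by
    filter_upwards [hopen.mem_nhds h₀, Metric.continuousAt_iff'.1 hc 1 one_pos] with α hα hd
    obtain ⟨a, ha⟩ := hint α hα
    obtain ⟨b, hb⟩ := hint α₀ h₀
    funext i
    have hi := (dist_le_pi_dist _ _ i).trans_lt hd
    have e : (chart q (cover r n α) - α) i - (chart q (cover r n α₀) - α₀) i
        = (((a i - b i) * (2 * r) : ℤ) : ℂ) := by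
      simp only [Pi.sub_apply, ha, hb]
      push_cast
      ring
    rw [dist_eq_norm, e, Complex.norm_intCast] at hi
    have hz : (a i - b i) * (2 * (r : ℤ)) = 0 := Int.abs_lt_one_iff.1 (by exact_mod_cast hi)
    rw [hz] at e
    simp only [Pi.sub_apply, Int.cast_zero] at e
    simp only [Pi.add_apply, Pi.sub_apply]
    linear_combination e
  refine DifferentiableAt.differentiableWithinAt ?_
  refine DifferentiableAt.congr_of_eventuallyEq
    (f := fun α => factor r C α (α + (chart q (cover r n α₀) - α₀))) ?_
    (hloc.mono fun α h => congrArg (factor r C α) h)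
  unfold factor zeta
  fun_prop

/-- The coordinate of the section `s` in the local trivialization with index `p`, as a function of
the point `α` in the chart at `p`. -/
def localCoord {r n : ℕ} {C : Matrix (Fin n) (Fin n) ℤ} (s : ∀ x, (lineBundle r C).Fiber x)
    (p α : Fin n → ℂ) : ℂ :=
  ((lineBundle r C).localTriv p ⟨cover r n α, s (cover r n α)⟩).2

end ADO

end

open scoped Kronecker
open ADO.Strand

noncomputable section

namespace ADO

/-! ### The exponential `ζ_{2r}^x` -/

/-! Only $E$ and the weights matter; $F$ enters through the $R$-matrix alone. Weight modules over
the Borel half, with $E$ acting on tensor products by $E\otimes K+1\otimes E$, are preserved by the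
braidings, cups and caps, so every diagram gives a homomorphism (`Diagram.isHom_matrix`). If
$\alpha_c\notin\mathbb Z$, the weights of $V_{\alpha_c}$ are distinct and $E$ moves each $v_i$,
$i>0$, to a nonzero multiple of $v_{i-1}$, so an endomorphism is a scalar: its entry
`Diagram.corner` at $v_0$. This entry is entire in all the colours.

Poles can therefore come only from the modified dimension, whose denominator `dimDen` has simple
zeros, exactly at the integers congruent to $0,\dots,r-2$ modulo $r$. This settles knots. With a
second component the corner has to vanish there. At such a zero, $E^{r-1}=0$ on $V_{\alpha_c}$. If
another colour is not an integer, some horizontal line carries a tensor factor $V_\alpha$ or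
$V_\alpha^*$ with $\alpha\notin\mathbb Z$, and its module is `Contractible`: the identity is an
$(r-1)$-fold twisted commutator of some $h$ with $E$. On vectors killed by $E$ this reads
$x=E^{r-1}hx$. Applied to the image of $v_0$ on that line, and pushed up to $V_{\alpha_c}$, it gives
zero (`Contractible.mulVec_eq_zero`, `Diagram.corner_eq_zero`). Density of the non-integers removes
the condition on the other colour, and Hadamard's lemma divides the corner by `dimDen`
(`exists_eq_mul_of_simple_zeros`).

Quasi-periodicity is local: under $\alpha_i\mapsto\alpha_i+2r$ only the factor $\zeta_{2r}^{\pm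
H\otimes H/2}$ of a crossing changes, by a scalar, and these scalars multiply to the linking matrix.
The cocycle identity `factor_mul` then turns a quasi-periodic function into a section. -/

theorem zeta_add (r : ℕ) (x y : ℂ) : zeta r (x + y) = zeta r x * zeta r y := by
  simp only [zeta, mul_add, Complex.exp_add]

theorem zeta_zero (r : ℕ) : zeta r 0 = 1 := by simp [zeta]

theorem zeta_ne_zero (r : ℕ) (x : ℂ) : zeta r x ≠ 0 := Complex.exp_ne_zero _

theorem zeta_neg (r : ℕ) (x : ℂ) : zeta r (-x) = (zeta r x)⁻¹ := by
  simp only [zeta, mul_neg, Complex.exp_neg]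

theorem zeta_sub (r : ℕ) (x y : ℂ) : zeta r (x - y) = zeta r x * (zeta r y)⁻¹ := by
  rw [sub_eq_add_neg, zeta_add, zeta_neg]

theorem zeta_nat_mul (r k : ℕ) (x : ℂ) : zeta r (k * x) = zeta r x ^ k := by
  rw [zeta, zeta, ← Complex.exp_nat_mul]
  ring_nf

theorem zeta_sum (r : ℕ) {ι : Type*} (s : Finset ι) (f : ι → ℂ) :
    zeta r (∑ i ∈ s, f i) = ∏ i ∈ s, zeta r (f i) := by
  simp only [zeta, Finset.mul_sum, Complex.exp_sum]

theorem zeta_eq_one_iff {r : ℕ} (hr : r ≠ 0) (x : ℂ) :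
    zeta r x = 1 ↔ ∃ k : ℤ, x = 2 * r * k := by
  have h1 : (r : ℂ) ≠ 0 := Nat.cast_ne_zero.2 hr
  have h2 : (Real.pi : ℂ) ≠ 0 := Complex.ofReal_ne_zero.2 Real.pi_ne_zero
  rw [zeta, Complex.exp_eq_one_iff]
  refine exists_congr fun k => ⟨fun h => ?_, fun h => ?_⟩
  · field_simp at h
    linear_combination h
  · rw [h]
    field_simp

theorem zeta_period {r : ℕ} (hr : r ≠ 0) (k : ℤ) : zeta r (2 * r * k) = 1 :=
  (zeta_eq_one_iff hr _).2 ⟨k, rfl⟩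

theorem zeta_add_period {r : ℕ} (hr : r ≠ 0) (x : ℂ) (k : ℤ) :
    zeta r (x + 2 * r * k) = zeta r x := by
  rw [zeta_add, zeta_period hr, mul_one]

theorem zeta_self {r : ℕ} (hr : r ≠ 0) : zeta r r = -1 := by
  have h1 : (r : ℂ) ≠ 0 := Nat.cast_ne_zero.2 hr
  rw [zeta, div_mul_cancel₀ _ h1, Complex.exp_pi_mul_I]

/-- The zeros of the quantum integers. -/
theorem zeta_sub_zeta_neg_eq_zero_iff {r : ℕ} (hr : r ≠ 0) (x : ℂ) :
    zeta r x - zeta r (-x) = 0 ↔ ∃ k : ℤ, x = r * k := by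
  have h : zeta r x - zeta r (-x) = 0 ↔ zeta r (2 * x) = 1 := by
    rw [sub_eq_zero, two_mul, zeta_add, zeta_neg, mul_eq_one_iff_eq_inv₀ (zeta_ne_zero r x)]
  rw [h, zeta_eq_one_iff hr]
  refine exists_congr fun k => ⟨fun h => ?_, fun h => ?_⟩
  · linear_combination h / 2
  · linear_combination 2 * h

theorem zeta_sub_zeta_neg_natCast_ne_zero {r k : ℕ} (h0 : 0 < k) (hk : k < r) :
    zeta r k - zeta r (-k) ≠ 0 := by
  rw [Ne, zeta_sub_zeta_neg_eq_zero_iff (by omega)]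
  rintro ⟨m, hm⟩
  have h : (k : ℤ) = r * m := by exact_mod_cast hm
  have h1 : 0 < m := by
    by_contra hc
    nlinarith
  nlinarith

theorem zeta_one_sub_ne_zero {r : ℕ} (hr : 2 ≤ r) : zeta r 1 - zeta r (-1) ≠ 0 := by
  have := zeta_sub_zeta_neg_natCast_ne_zero (r := r) one_pos (by omega)
  exact_mod_cast this

/-! ### The `R`-matrix commutes with the action of `E` -/

/-- A matrix which moves each basis vector to a multiple of the previous one. -/
def shiftDown (r : ℕ) (ε : ℕ → ℂ) : Matrix (Fin r) (Fin r) ℂ :=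
  Matrix.of fun k i => if (k : ℕ) + 1 = i then ε i else 0

/-- A matrix which moves each basis vector to a multiple of the next one. -/
def shiftUp (r : ℕ) (φ : ℕ → ℂ) : Matrix (Fin r) (Fin r) ℂ :=
  Matrix.of fun k i => if (k : ℕ) = i + 1 then φ i else 0

theorem shiftDown_mul_shiftUp (r : ℕ) (ε φ : ℕ → ℂ) (h : φ (r - 1) = 0) :
    shiftDown r ε * shiftUp r φ = Matrix.diagonal fun i : Fin r => ε (i + 1) * φ i := by
  ext k i
  simp only [Matrix.mul_apply, shiftDown, shiftUp, Matrix.of_apply, Matrix.diagonal_apply]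
  by_cases hi : (i : ℕ) + 1 < r
  · rw [Finset.sum_eq_single ⟨i + 1, hi⟩]
    · simp only [if_true, add_left_inj, ← Fin.ext_iff]
      split_ifs with h1
      · subst h1; rfl
      · simp
    · intro b _ hb
      rw [if_neg (c := (b : ℕ) = i + 1) fun h => hb (Fin.ext h), mul_zero]
    · simp
  · have e : (i : ℕ) = r - 1 := by omega
    rw [Finset.sum_eq_zero]
    · split_ifs with h1
      · subst h1
        rw [e, h, mul_zero]
      · rfl
    · intro b _
      rw [if_neg (c := (b : ℕ) = i + 1) (by omega), mul_zero]

theorem shiftUp_mul_shiftDown (r : ℕ) (ε φ : ℕ → ℂ) :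
    shiftUp r φ * shiftDown r ε =
      Matrix.diagonal fun i : Fin r => if (i : ℕ) = 0 then 0 else φ (i - 1) * ε i := by
  ext k i
  simp only [Matrix.mul_apply, shiftDown, shiftUp, Matrix.of_apply, Matrix.diagonal_apply]
  by_cases hi : (i : ℕ) = 0
  · rw [Finset.sum_eq_zero]
    · split_ifs with h1 <;> first | rfl | (subst h1; omega)
    · intro b _
      rw [if_neg (c := (b : ℕ) + 1 = i) (by omega), mul_zero]
  · rw [Finset.sum_eq_single ⟨i - 1, by omega⟩]
    · have e : (i : ℕ) - 1 + 1 = i := by omega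
      simp only [e, if_true, ← Fin.ext_iff]
      by_cases h1 : k = i
      · subst h1
        simp [hi]
      · simp [h1]
    · intro b _ hb
      rw [if_neg (c := (b : ℕ) + 1 = i) fun h => hb (Fin.ext (by simp; omega)), mul_zero]
    · simp

theorem opE_eq_shiftDown (r : ℕ) (α : ℂ) : opE r α = shiftDown r fun i =>
    (zeta r (α - i + 1) - zeta r (-(α - i + 1))) / (zeta r 1 - zeta r (-1)) := rfl

theorem opF_eq_shiftUp (r : ℕ) : opF r = shiftUp r fun i =>
    (zeta r (i + 1) - zeta r (-(i + 1))) / (zeta r 1 - zeta r (-1)) := rfl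

/-- The action of `K ^ s` on `V_α`. -/
def opK (r : ℕ) (s α : ℂ) : Matrix (Fin r) (Fin r) ℂ :=
  Matrix.diagonal fun i => zeta r (s * weight α i)

/-- Both products are diagonal in the basis $v_i$, so the relation is an identity between quantum
integers. -/
theorem opE_opF_commutator {r : ℕ} (hr : 2 ≤ r) (β : ℂ) :
    (zeta r 1 - zeta r (-1)) • (opE r β * opF r - opF r * opE r β) =
      opK r 1 β - opK r (-1) β := by
  have hq := zeta_one_sub_ne_zero hr
  rw [opE_eq_shiftDown, opF_eq_shiftUp, shiftUp_mul_shiftDown, shiftDown_mul_shiftUp, opK, opK]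
  -- The product $EF$ is diagonal only if $Fv_{r-1}=0$, that is, if the quantum integer $[r]$
  -- vanishes; this holds because $\zeta_{2r}^r=-1$.
  swap
  · have h1 : ((r - 1 : ℕ) : ℂ) + 1 = r := by
      push_cast [Nat.cast_sub (by omega : 1 ≤ r)]
      ring
    rw [h1, zeta_neg, zeta_self (by omega)]
    norm_num
  rw [Matrix.diagonal_sub, Matrix.diagonal_sub, ← Matrix.diagonal_smul]
  congr 1
  funext i
  simp only [Pi.smul_apply, smul_eq_mul, weight]
  -- This is $[x][y+1]-[y][x+1]=[x-y]$, to be used with $x=\beta-i$ and $y=i$.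
  have key : ∀ x y : ℂ,
      (zeta r 1 - zeta r (-1)) * ((zeta r x - zeta r (-x)) / (zeta r 1 - zeta r (-1)) *
        ((zeta r (y + 1) - zeta r (-(y + 1))) / (zeta r 1 - zeta r (-1))) -
        (zeta r y - zeta r (-y)) / (zeta r 1 - zeta r (-1)) *
        ((zeta r (x + 1) - zeta r (-(x + 1))) / (zeta r 1 - zeta r (-1)))) =
      zeta r (1 * (x - y)) - zeta r (-1 * (x - y)) := by
    intro x y
    have h1 := zeta_ne_zero r 1
    have hx := zeta_ne_zero r x
    have hy := zeta_ne_zero r y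
    field_simp
    simp only [neg_sub, zeta_sub, neg_add, zeta_add, zeta_neg]
    field_simp
    ring
  have k1 := key (β - (i : ℕ)) (i : ℕ)
  have e1 : β - ((i + 1 : ℕ) : ℂ) + 1 = β - (i : ℕ) := by push_cast; ring
  have e2 : β - (i : ℕ) - (i : ℕ) = β - 2 * (i : ℕ) := by ring
  rw [e2] at k1
  rw [e1, ← k1]
  split_ifs with h0
  · simp [h0]
  · have e3 : ((i - 1 : ℕ) : ℂ) + 1 = (i : ℕ) := by
      push_cast [Nat.cast_sub (by omega : 1 ≤ (i : ℕ))]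
      ring
    rw [e3]

theorem opK_mul_opF (r : ℕ) (s β : ℂ) :
    opK r s β * opF r = zeta r (-2 * s) • (opF r * opK r s β) := by
  ext k i
  simp only [opK, opF, Matrix.diagonal_mul, Matrix.mul_diagonal, Matrix.smul_apply, smul_eq_mul,
    Matrix.of_apply, weight]
  split_ifs with h
  · rw [h, mul_comm, mul_left_comm, ← zeta_add]
    congr 2
    push_cast
    ring
  · simp

theorem opK_mul_opF_pow (r : ℕ) (s β : ℂ) (k : ℕ) :
    opK r s β * opF r ^ k = zeta r (-2 * s * k) • (opF r ^ k * opK r s β) := by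
  induction k with
  | zero => simp [zeta_zero]
  | succ k ih =>
    rw [pow_succ, ← mul_assoc, ih, smul_mul_assoc, Matrix.mul_assoc _ (opK r s β), opK_mul_opF, mul_smul_comm, smul_smul,
      ← mul_assoc, ← zeta_add]
    push_cast
    ring_nf

theorem opE_opF_pow_commutator {r : ℕ} (hr : 2 ≤ r) (β : ℂ) (k : ℕ) :
    (zeta r 1 - zeta r (-1)) ^ 2 • (opE r β * opF r ^ (k + 1) - opF r ^ (k + 1) * opE r β) =
      (zeta r (k + 1) - zeta r (-(k + 1))) •
        (opF r ^ k * (zeta r (-k) • opK r 1 β - zeta r k • opK r (-1) β)) := by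
  induction k with
  | zero =>
    have := opE_opF_commutator hr β
    simp only [zero_add, pow_one, pow_zero, one_mul, Nat.cast_zero, neg_zero, zeta_zero, one_smul,
      sq, mul_smul, this]
  | succ k ih =>
    have e : opE r β * opF r ^ (k + 1 + 1) - opF r ^ (k + 1 + 1) * opE r β =
        (opE r β * opF r ^ (k + 1) - opF r ^ (k + 1) * opE r β) * opF r +
          opF r ^ (k + 1) * (opE r β * opF r - opF r * opE r β) := by
      rw [pow_succ (opF r) (k + 1)]
      noncomm_ring
    rw [e, smul_add, ← smul_mul_assoc, ih, sq, mul_smul, ← mul_smul_comm (_ - _) (opF r ^ (k + 1)),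
      opE_opF_commutator hr, smul_mul_assoc, mul_assoc, sub_mul, smul_mul_assoc, smul_mul_assoc,
      opK_mul_opF, opK_mul_opF, ← mul_smul_comm, ← mul_smul_comm, ← mul_smul_comm, ← mul_smul_comm,
      ← mul_smul_comm, ← mul_smul_comm, pow_succ]
    simp only [mul_assoc, ← mul_sub, ← mul_add, ← mul_smul_comm]
    congr 2
    simp only [smul_sub, smul_smul]
    have h1 := zeta_ne_zero r 1
    have hk := zeta_ne_zero r k
    -- `a1` and `a2` compare the coefficients of $K$ and of $K^{-1}$. With $q=\zeta_{2r}$ the sides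
    -- of `a1` are both $q-q^{-2k-3}$, those of `a2` both $q^{2k+3}-q^{-1}$.
    have a1 : (zeta r (k + 1) - zeta r (-(k + 1))) * (zeta r (-k) * zeta r (-2 * 1)) +
        (zeta r 1 - zeta r (-1)) =
        (zeta r ((k + 1 : ℕ) + 1) - zeta r (-((k + 1 : ℕ) + 1))) * zeta r (-(k + 1 : ℕ)) := by
      have e2 : (-2 : ℂ) * 1 = -(1 + 1) := by ring
      rw [e2]
      push_cast
      simp only [zeta_neg, zeta_add]
      field_simp
      ring
    have a2 : (zeta r (k + 1) - zeta r (-(k + 1))) * (zeta r k * zeta r (-2 * -1)) +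
        (zeta r 1 - zeta r (-1)) =
        (zeta r ((k + 1 : ℕ) + 1) - zeta r (-((k + 1 : ℕ) + 1))) * zeta r (k + 1 : ℕ) := by
      have e2 : (-2 : ℂ) * -1 = (1 + 1) := by ring
      rw [e2]
      push_cast
      simp only [zeta_neg, zeta_add]
      field_simp
      ring
    rw [← a1, ← a2, add_smul, add_smul]
    abel

/-- A truncated exponential sum in `E ⊗ F`. -/
def theta (r : ℕ) (c : ℕ → ℂ) (α : ℂ) : Matrix (Fin r × Fin r) (Fin r × Fin r) ℂ :=
  ∑ k ∈ Finset.range r, c k • ((opE r α ^ k) ⊗ₖ (opF r ^ k))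

theorem shiftDown_pow_apply (r : ℕ) (ε : ℕ → ℂ) (l : ℕ) (k i : Fin r) :
    (shiftDown r ε ^ l) k i =
      if (k : ℕ) + l = i then ∏ m ∈ Finset.range l, ε (k + m + 1) else 0 := by
  induction l generalizing k with
  | zero => simp [Matrix.one_apply, Fin.ext_iff]
  | succ l ih =>
    rw [pow_succ', Matrix.mul_apply]
    by_cases hk : (k : ℕ) + 1 < r
    · rw [Finset.sum_eq_single ⟨k + 1, hk⟩]
      · rw [ih]
        simp only [shiftDown, Matrix.of_apply, if_true, Finset.prod_range_succ']
        have e : (k : ℕ) + 1 + l = i ↔ (k : ℕ) + (l + 1) = i := by omega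
        simp only [e]
        split_ifs
        · rw [mul_comm]
          congr 1
          exact Finset.prod_congr rfl fun m _ => by congr 1; ring
        · simp
      · intro b _ hb
        rw [shiftDown, Matrix.of_apply, if_neg fun h => hb (Fin.ext h.symm), zero_mul]
      · simp
    · rw [Finset.sum_eq_zero, if_neg (by omega)]
      intro b _
      rw [shiftDown, Matrix.of_apply, if_neg (by omega), zero_mul]

theorem opE_pow_self (r : ℕ) (α : ℂ) : opE r α ^ r = 0 := by
  ext k i
  rw [opE_eq_shiftDown, shiftDown_pow_apply, if_neg (by omega), Matrix.zero_apply]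

/-- Compare the terms with $E^{k+1}$ in the first factor: $1\otimes B$ contributes
$c_{k+1}[B,F^{k+1}]$, while $E\otimes M$ and $E\otimes N$ contribute $c_k(F^kM-NF^k)$. The lowest
term of the first kind vanishes because $B$ commutes with $F^0$, the highest of the second because
$E^r=0$. Hence the truncation leaves no remainder. -/
theorem theta_commutator {r : ℕ} (hr : 2 ≤ r) (c : ℕ → ℂ) (α : ℂ)
    (B M N : Matrix (Fin r) (Fin r) ℂ)
    (h : ∀ k, k + 1 < r → c (k + 1) • (B * opF r ^ (k + 1) - opF r ^ (k + 1) * B) =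
      c k • (opF r ^ k * M - N * opF r ^ k)) :
    theta r c α * (opE r α ⊗ₖ M + 1 ⊗ₖ B) = (opE r α ⊗ₖ N + 1 ⊗ₖ B) * theta r c α := by
  obtain ⟨r', rfl⟩ : ∃ r', r = r' + 1 := ⟨r - 1, by omega⟩
  have h1 : (1 ⊗ₖ B) * theta (r' + 1) c α - theta (r' + 1) c α * (1 ⊗ₖ B) =
      ∑ k ∈ Finset.range (r' + 1), c k • ((opE (r' + 1) α ^ k) ⊗ₖ
        (B * opF (r' + 1) ^ k - opF (r' + 1) ^ k * B)) := by
    simp only [theta, Finset.mul_sum, Finset.sum_mul, mul_smul_comm, smul_mul_assoc,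
      ← Matrix.mul_kronecker_mul, one_mul, mul_one, ← Finset.sum_sub_distrib, ← smul_sub]
    refine Finset.sum_congr rfl fun k _ => ?_
    congr 1
    ext; simp [mul_sub]
  have h2 : theta (r' + 1) c α * (opE (r' + 1) α ⊗ₖ M) - (opE (r' + 1) α ⊗ₖ N) *
      theta (r' + 1) c α =
      ∑ k ∈ Finset.range (r' + 1), c k • ((opE (r' + 1) α ^ (k + 1)) ⊗ₖ
        (opF (r' + 1) ^ k * M - N * opF (r' + 1) ^ k)) := by
    simp only [theta, Finset.mul_sum, Finset.sum_mul, mul_smul_comm, smul_mul_assoc,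
      ← Matrix.mul_kronecker_mul, ← pow_succ, ← pow_succ', ← Finset.sum_sub_distrib, ← smul_sub]
    refine Finset.sum_congr rfl fun k _ => ?_
    congr 1
    ext; simp [mul_sub]
  rw [Finset.sum_range_succ'] at h1
  rw [Finset.sum_range_succ, opE_pow_self] at h2
  have h3 : (1 ⊗ₖ B) * theta (r' + 1) c α - theta (r' + 1) c α * (1 ⊗ₖ B) =
      theta (r' + 1) c α * (opE (r' + 1) α ⊗ₖ M) - (opE (r' + 1) α ⊗ₖ N) *
      theta (r' + 1) c α := by
    rw [h1, h2]
    simp only [pow_zero, mul_one, one_mul, sub_self, Matrix.kronecker_zero, smul_zero, add_zero,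
      Matrix.zero_kronecker]
    refine Finset.sum_congr rfl fun k hk => ?_
    rw [← Matrix.kronecker_smul, h k (by simpa using hk), Matrix.kronecker_smul]
  rw [mul_add, add_mul]
  rw [sub_eq_sub_iff_add_eq_add] at h3
  rw [← h3]
  exact add_comm _ _

/-- As $E$ raises the weight by $2$, passing $\zeta_{2r}^{sH\otimes H/2}$ across $E$ in one factor
leaves $\zeta_{2r}^{sH}=K^s$ in the other. -/
theorem opHH_mul_opE_kronecker (r : ℕ) (s t α β : ℂ) :
    opHH r s α β * (opE r α ⊗ₖ opK r t β) = (opE r α ⊗ₖ opK r (t + s) β) * opHH r s α β := by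
  ext ⟨a, b⟩ ⟨a', b'⟩
  simp only [opHH, opK, Matrix.diagonal_mul, Matrix.mul_diagonal, Matrix.kroneckerMap_apply, opE,
    Matrix.of_apply, Matrix.diagonal_apply]
  split_ifs with h1 h2
  · subst h2
    rw [mul_left_comm, ← zeta_add, mul_assoc, ← zeta_add]
    congr 2
    simp only [weight, ← h1]
    push_cast
    ring
  all_goals simp

theorem opHH_mul_kronecker_opE (r : ℕ) (s t α β : ℂ) :
    opHH r s α β * (opK r t α ⊗ₖ opE r β) = (opK r (t + s) α ⊗ₖ opE r β) * opHH r s α β := by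
  ext ⟨a, b⟩ ⟨a', b'⟩
  simp only [opHH, opK, Matrix.diagonal_mul, Matrix.mul_diagonal, Matrix.kroneckerMap_apply, opE,
    Matrix.of_apply, Matrix.diagonal_apply]
  split_ifs with h2 h1 h1
  · subst h2
    rw [← mul_assoc, ← zeta_add, mul_right_comm, ← zeta_add]
    congr 2
    simp only [weight, ← h1]
    push_cast
    ring
  all_goals simp

theorem opK_zero (r : ℕ) (α : ℂ) : opK r 0 α = 1 := by
  simp [opK, zeta_zero]

theorem qPochhammer_succ (r k : ℕ) :
    qPochhammer (zeta r (-2)) (zeta r (-2)) (k + 1) =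
      qPochhammer (zeta r (-2)) (zeta r (-2)) k *
        (zeta r (-(k + 1)) * (zeta r (k + 1) - zeta r (-(k + 1)))) := by
  rw [qPochhammer, qPochhammer, Finset.prod_range_succ, ← zeta_nat_mul]
  congr 1
  rw [mul_sub, ← zeta_add, ← zeta_add, ← zeta_add, neg_add_cancel, zeta_zero]
  ring_nf

/-- Reduces the hypothesis of `theta_commutator` to a recursion for the scalars $c_k$. The scalar
$u$ is what remains when $F^kM-NF^k$ is brought to the shape of the commutator formula
`opE_opF_pow_commutator`. -/
theorem theta_condition {r : ℕ} (hr : 2 ≤ r) (β : ℂ) (c : ℕ → ℂ) (k : ℕ)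
    (M N : Matrix (Fin r) (Fin r) ℂ) (u : ℂ)
    (hc : c (k + 1) * (zeta r (k + 1) - zeta r (-(k + 1))) =
      c k * u * (zeta r 1 - zeta r (-1)) ^ 2)
    (hMN : opF r ^ k * M - N * opF r ^ k =
      u • (opF r ^ k * (zeta r (-k) • opK r 1 β - zeta r k • opK r (-1) β))) :
    c (k + 1) • (opE r β * opF r ^ (k + 1) - opF r ^ (k + 1) * opE r β) =
      c k • (opF r ^ k * M - N * opF r ^ k) := by
  have hq := pow_ne_zero 2 (zeta_one_sub_ne_zero hr)
  have h := opE_opF_pow_commutator hr β k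
  rw [hMN]
  refine smul_right_injective _ hq ?_
  simp only
  rw [smul_comm, h, smul_smul, smul_smul, smul_smul, hc]
  congr 1
  ring

/-- The coefficients of the truncated `R`-matrix. -/
def rCoeff (r k : ℕ) : ℂ := (zeta r 1 - zeta r (-1)) ^ (2 * k) /
  (zeta r k * qPochhammer (zeta r (-2)) (zeta r (-2)) k)

/-- The coefficients of the inverse of the truncated `R`-matrix. -/
def rInvCoeff (r k : ℕ) : ℂ := (-1) ^ k * (zeta r 1 - zeta r (-1)) ^ (2 * k) /
  (zeta r ((k : ℂ) ^ 2) * qPochhammer (zeta r (-2)) (zeta r (-2)) k)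

/-- The factor $\Theta=\sum c_kE^k\otimes F^k$ carries $E\otimes K+1\otimes E$ to $E\otimes
K^{-1}+1\otimes E$, and $\zeta_{2r}^{H\otimes H/2}$ carries this to the opposite coproduct $E\otimes
1+K\otimes E$. -/
theorem opR_mul {r : ℕ} (hr : 2 ≤ r) (α β : ℂ) :
    opR r α β * (opE r α ⊗ₖ opK r 1 β + 1 ⊗ₖ opE r β) =
      (opE r α ⊗ₖ 1 + opK r 1 α ⊗ₖ opE r β) * opR r α β := by
  have key := theta_commutator hr (rCoeff r) α (opE r β) (opK r 1 β)
      (opK r (-1) β) fun k hk => by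
    -- $u=\zeta_{2r}^k$ because $K^{-1}F^k=\zeta_{2r}^{2k}F^kK^{-1}$, hence
    -- $F^kK-K^{-1}F^k=\zeta_{2r}^kF^k(\zeta_{2r}^{-k}K-\zeta_{2r}^kK^{-1})$.
    refine theta_condition hr β _ k _ _ (zeta r k) ?_ ?_
    · have h0 := zeta_sub_zeta_neg_natCast_ne_zero (Nat.succ_pos k) hk
      push_cast at h0
      simp only [rCoeff, qPochhammer_succ]
      have h1 : zeta r ((k + 1 : ℕ) : ℂ) * zeta r (-(k + 1)) = 1 := by
        rw [← zeta_add]; push_cast; rw [add_neg_cancel, zeta_zero]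
      rw [show zeta r ((k + 1 : ℕ) : ℂ) * (qPochhammer (zeta r (-2)) (zeta r (-2)) k *
        (zeta r (-(k + 1)) * (zeta r (k + 1) - zeta r (-(k + 1))))) =
        qPochhammer (zeta r (-2)) (zeta r (-2)) k * (zeta r (k + 1) - zeta r (-(k + 1))) *
        (zeta r ((k + 1 : ℕ) : ℂ) * zeta r (-(k + 1))) by ring, h1, mul_one]
      have := zeta_ne_zero r k
      rw [← div_div, div_mul_cancel₀ _ h0]
      field_simp
      ring
    · rw [opK_mul_opF_pow, ← mul_smul_comm, ← mul_smul_comm, ← mul_sub]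
      congr 1
      rw [smul_sub, smul_smul, smul_smul, ← zeta_add, ← zeta_add, add_neg_cancel, zeta_zero,
        one_smul]
      ring_nf
  have e : opR r α β = opHH r 1 α β * theta r (rCoeff r) α := rfl
  have h1 := opHH_mul_opE_kronecker r 1 (-1) α β
  have h2 := opHH_mul_kronecker_opE r 1 0 α β
  rw [neg_add_cancel, opK_zero] at h1
  rw [zero_add, opK_zero] at h2
  rw [e, mul_assoc, key, ← mul_assoc, mul_add, h1, h2, ← add_mul, mul_assoc]

/-- Rather than inverting $R$, the argument checks the recursion for the coefficients of the inverse
directly. Now $M=K^{-1}$ and $N=K$, which gives $u=-\zeta_{2r}^{-k}$. -/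
theorem opRInv_mul {r : ℕ} (hr : 2 ≤ r) (α β : ℂ) :
    opRInv r α β * (opE r α ⊗ₖ 1 + opK r 1 α ⊗ₖ opE r β) =
      (opE r α ⊗ₖ opK r 1 β + 1 ⊗ₖ opE r β) * opRInv r α β := by
  have key := theta_commutator hr (rInvCoeff r) α (opE r β)
      (opK r (-1) β) (opK r 1 β) fun k hk => by
    refine theta_condition hr β _ k _ _ (-zeta r (-k)) ?_ ?_
    · have h0 := zeta_sub_zeta_neg_natCast_ne_zero (Nat.succ_pos k) hk
      push_cast at h0
      simp only [rInvCoeff, qPochhammer_succ]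
      have h1 : zeta r (((k + 1 : ℕ) : ℂ) ^ 2) * zeta r (-(k + 1)) =
          zeta r ((k : ℂ) ^ 2) * zeta r k := by
        rw [← zeta_add, ← zeta_add]; push_cast; ring_nf
      rw [show zeta r (((k + 1 : ℕ) : ℂ) ^ 2) * (qPochhammer (zeta r (-2)) (zeta r (-2)) k *
        (zeta r (-(k + 1)) * (zeta r (k + 1) - zeta r (-(k + 1))))) =
        qPochhammer (zeta r (-2)) (zeta r (-2)) k * (zeta r (((k + 1 : ℕ) : ℂ) ^ 2) *
        zeta r (-(k + 1))) * (zeta r (k + 1) - zeta r (-(k + 1))) by ring, h1, zeta_neg r k]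
      have := zeta_ne_zero r k
      rw [← div_div, div_mul_cancel₀ _ h0]
      field_simp
      ring
    · rw [opK_mul_opF_pow, ← mul_smul_comm, ← mul_smul_comm, ← mul_sub]
      congr 1
      rw [smul_sub, smul_smul, smul_smul, neg_mul (zeta r _), neg_mul (zeta r _), ← zeta_add,
        ← zeta_add, neg_add_cancel, zeta_zero, neg_smul, neg_smul, one_smul,
        show (-2 : ℂ) * 1 * k = -k + -k by ring]
      abel
  have e : opRInv r α β = theta r (rInvCoeff r) α * opHH r (-1) α β :=
    rfl
  have h1 := opHH_mul_opE_kronecker r (-1) 0 α β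
  have h2 := opHH_mul_kronecker_opE r (-1) 1 α β
  rw [zero_add, opK_zero] at h1
  rw [add_neg_cancel, opK_zero] at h2
  rw [e, mul_assoc, mul_add (opHH _ _ _ _), h1, h2, ← add_mul, ← mul_assoc, key, mul_assoc]

/-! ### Weight modules over the Borel subalgebra -/

/-- A weight module over the subalgebra generated by `E` and `H`, with a basis of weight vectors
indexed by `S`. -/
structure BorelModule (S : Type) where
  /-- The weight of a basis vector. -/
  wt : S → ℂ
  /-- The action of `E`. -/
  E : Matrix S S ℂ
  wt_E : ∀ b a, E b a ≠ 0 → wt b = wt a + 2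

/-- The trivial module. -/
def BorelModule.unit : BorelModule Unit := ⟨fun _ => 0, 0, by simp⟩

/-- The tensor product, where `E` acts by `E ⊗ K + 1 ⊗ E`. -/
def BorelModule.tensor (r : ℕ) {S T : Type} [DecidableEq S] [DecidableEq T]
    (M : BorelModule S) (N : BorelModule T) : BorelModule (S × T) where
  wt p := M.wt p.1 + N.wt p.2
  E := M.E ⊗ₖ Matrix.diagonal (fun t => zeta r (N.wt t)) + 1 ⊗ₖ N.E
  wt_E := by
    rintro ⟨b, d⟩ ⟨a, c⟩ h
    by_cases h1 : M.E b a * Matrix.diagonal (fun t => zeta r (N.wt t)) d c = 0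
    · by_cases h2 : (1 : Matrix S S ℂ) b a * N.E d c = 0
      · exact absurd (by simp only [Matrix.add_apply, Matrix.kroneckerMap_apply, h1, h2,
          add_zero]) h
      · obtain ⟨h3, h4⟩ := mul_ne_zero_iff.1 h2
        have e : b = a := by
          by_contra hc
          exact h3 (Matrix.one_apply_ne hc)
        simp only [e, N.wt_E d c h4]
        ring
    · obtain ⟨h3, h4⟩ := mul_ne_zero_iff.1 h1
      have e : d = c := by
        by_contra hc
        exact h4 (Matrix.diagonal_apply_ne _ hc)
      simp only [e, M.wt_E b a h3]
      ring

/-- A matrix which maps each basis vector of weight `x` to vectors of weight `x + d`. -/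
def IsHomogeneous {S T : Type} (wt : S → ℂ) (wt' : T → ℂ) (d : ℂ) (A : Matrix T S ℂ) : Prop :=
  ∀ b a, A b a ≠ 0 → wt' b = wt a + d

/-- A homomorphism of weight modules. -/
structure BorelModule.IsHom {S T : Type} [Fintype S] [Fintype T] (M : BorelModule S)
    (N : BorelModule T) (A : Matrix T S ℂ) : Prop where
  homogeneous : IsHomogeneous M.wt N.wt 0 A
  mul_E : A * M.E = N.E * A

theorem IsHomogeneous.zeta_mul {r : ℕ} {S T : Type} [Fintype S] [Fintype T] [DecidableEq S]
    [DecidableEq T] {wt : S → ℂ} {wt' : T → ℂ} {d : ℂ} {A : Matrix T S ℂ}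
    (h : IsHomogeneous wt wt' d A) (s : ℂ) :
    Matrix.diagonal (fun t => zeta r (s * wt' t)) * A =
      zeta r (s * d) • (A * Matrix.diagonal fun t => zeta r (s * wt t)) := by
  ext b a
  simp only [Matrix.diagonal_mul, Matrix.mul_diagonal, Matrix.smul_apply, smul_eq_mul]
  by_cases h0 : A b a = 0
  · simp [h0]
  · rw [h b a h0, mul_add, zeta_add]
    ring

theorem IsHomogeneous.mul {S T U : Type} [Fintype T] {wt : S → ℂ} {wt' : T → ℂ} {wt'' : U → ℂ}
    {d e : ℂ} {A : Matrix T S ℂ} {B : Matrix U T ℂ} (hB : IsHomogeneous wt' wt'' e B)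
    (hA : IsHomogeneous wt wt' d A) : IsHomogeneous wt wt'' (d + e) (B * A) := by
  intro b a h
  obtain ⟨c, _, hc⟩ := Finset.exists_ne_zero_of_sum_ne_zero h
  obtain ⟨h1, h2⟩ := mul_ne_zero_iff.1 hc
  rw [hB b c h1, hA c a h2]
  ring

theorem IsHomogeneous.kronecker {S T S' T' : Type} {wt₁ : S → ℂ} {wt₂ : T → ℂ} {wt₁' : S' → ℂ}
    {wt₂' : T' → ℂ} {d e : ℂ} {A : Matrix S' S ℂ} {B : Matrix T' T ℂ}
    (hA : IsHomogeneous wt₁ wt₁' d A) (hB : IsHomogeneous wt₂ wt₂' e B) :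
    IsHomogeneous (fun p : S × T => wt₁ p.1 + wt₂ p.2) (fun p : S' × T' => wt₁' p.1 + wt₂' p.2)
      (d + e) (A ⊗ₖ B) := by
  intro b a h
  obtain ⟨h1, h2⟩ := mul_ne_zero_iff.1 h
  simp only [hA _ _ h1, hB _ _ h2]
  ring

theorem IsHomogeneous.add {S T : Type} {wt : S → ℂ} {wt' : T → ℂ} {d : ℂ} {A B : Matrix T S ℂ}
    (hA : IsHomogeneous wt wt' d A) (hB : IsHomogeneous wt wt' d B) :
    IsHomogeneous wt wt' d (A + B) := by
  intro b a h
  by_cases h1 : A b a = 0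
  · exact hB b a fun h2 => h (by simp [h1, h2])
  · exact hA b a h1

theorem IsHomogeneous.smul {S T : Type} {wt : S → ℂ} {wt' : T → ℂ} {d : ℂ} {A : Matrix T S ℂ}
    (hA : IsHomogeneous wt wt' d A) (z : ℂ) : IsHomogeneous wt wt' d (z • A) :=
  fun b a h => hA b a (mul_ne_zero_iff.1 h).2

theorem IsHomogeneous.sum {S T ι : Type} {wt : S → ℂ} {wt' : T → ℂ} {d : ℂ} (s : Finset ι)
    {A : ι → Matrix T S ℂ} (hA : ∀ i, IsHomogeneous wt wt' d (A i)) :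
    IsHomogeneous wt wt' d (∑ i ∈ s, A i) := by
  intro b a h
  rw [Matrix.sum_apply] at h
  obtain ⟨c, _, hc⟩ := Finset.exists_ne_zero_of_sum_ne_zero h
  exact hA c b a hc

theorem isHomogeneous_diagonal {S : Type} [DecidableEq S] (wt : S → ℂ) (f : S → ℂ) :
    IsHomogeneous wt wt 0 (Matrix.diagonal f) := by
  intro b a h
  have e : b = a := by
    by_contra hc
    exact h (Matrix.diagonal_apply_ne _ hc)
  rw [e, add_zero]

theorem isHomogeneous_one {S : Type} [DecidableEq S] (wt : S → ℂ) :
    IsHomogeneous wt wt 0 (1 : Matrix S S ℂ) := by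
  rw [← Matrix.diagonal_one]
  exact isHomogeneous_diagonal wt _

namespace BorelModule

theorem tensor_assoc_wt (r : ℕ) {S T U : Type} [DecidableEq S] [DecidableEq T] [DecidableEq U]
    (M : BorelModule S) (N : BorelModule T) (P : BorelModule U) :
    (M.tensor r (N.tensor r P)).wt =
      ((M.tensor r N).tensor r P).wt ∘ (Equiv.prodAssoc S T U).symm := by
  funext ⟨a, b, c⟩
  simp [tensor, add_assoc]

/-- With either bracketing $E$ acts by $E\otimes K\otimes K+1\otimes E\otimes K+1\otimes 1\otimes
E$. -/
theorem tensor_assoc_E (r : ℕ) {S T U : Type} [DecidableEq S] [DecidableEq T] [DecidableEq U]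
    (M : BorelModule S) (N : BorelModule T) (P : BorelModule U) :
    (M.tensor r (N.tensor r P)).E =
      ((M.tensor r N).tensor r P).E.submatrix (Equiv.prodAssoc S T U).symm
        (Equiv.prodAssoc S T U).symm := by
  ext ⟨a, b, c⟩ ⟨a', b', c'⟩
  simp only [tensor, Matrix.add_apply, Matrix.kroneckerMap_apply, Matrix.submatrix_apply,
    Equiv.prodAssoc_symm_apply, Matrix.diagonal_apply, Matrix.one_apply, Prod.mk.injEq, zeta_add]
  by_cases h1 : a = a' <;> by_cases h2 : b = b' <;> by_cases h3 : c = c' <;>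
    simp [h1, h2, h3] <;> ring

theorem unit_tensor_wt (r : ℕ) {S : Type} [DecidableEq S] (M : BorelModule S) :
    M.wt = (unit.tensor r M).wt ∘ (Equiv.punitProd S).symm := by
  funext a
  simp [tensor, unit]

theorem unit_tensor_E (r : ℕ) {S : Type} [DecidableEq S] (M : BorelModule S) :
    M.E = (unit.tensor r M).E.submatrix (Equiv.punitProd S).symm (Equiv.punitProd S).symm := by
  ext a b
  simp [tensor, unit]

variable {S T U S' T' : Type} [Fintype S] [Fintype T] [Fintype U] [Fintype S'] [Fintype T']

theorem IsHom.one [DecidableEq S] (M : BorelModule S) : M.IsHom M 1 :=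
  ⟨isHomogeneous_one _, by rw [one_mul, mul_one]⟩

theorem IsHom.mul {M : BorelModule S} {N : BorelModule T} {P : BorelModule U} {A : Matrix T S ℂ}
    {B : Matrix U T ℂ} (hB : N.IsHom P B) (hA : M.IsHom N A) : M.IsHom P (B * A) := by
  refine ⟨?_, ?_⟩
  · have := hB.homogeneous.mul hA.homogeneous
    rwa [add_zero] at this
  · rw [Matrix.mul_assoc, hA.mul_E, ← Matrix.mul_assoc, hB.mul_E, Matrix.mul_assoc]

theorem IsHom.tensor_one (r : ℕ) [DecidableEq S] [DecidableEq S'] [DecidableEq T]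
    {M : BorelModule S} {M' : BorelModule S'} {A : Matrix S' S ℂ} (hA : M.IsHom M' A)
    (N : BorelModule T) : (M.tensor r N).IsHom (M'.tensor r N) (A ⊗ₖ 1) := by
  refine ⟨?_, ?_⟩
  · have := hA.homogeneous.kronecker (isHomogeneous_one N.wt)
    rwa [add_zero] at this
  · simp only [tensor, Matrix.mul_add, Matrix.add_mul, ← Matrix.mul_kronecker_mul, Matrix.one_mul,
      Matrix.mul_one, hA.mul_E]

/-- This is where a homomorphism has to preserve weights: the summand $E\otimes K$ commutes with
$1\otimes A$ only because $A$ commutes with $K$. -/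
theorem IsHom.one_tensor (r : ℕ) [DecidableEq S] [DecidableEq T] [DecidableEq T']
    {N : BorelModule T} {N' : BorelModule T'} {A : Matrix T' T ℂ} (M : BorelModule S)
    (hA : N.IsHom N' A) : (M.tensor r N).IsHom (M.tensor r N') (1 ⊗ₖ A) := by
  refine ⟨?_, ?_⟩
  · have := (isHomogeneous_one M.wt).kronecker hA.homogeneous
    rwa [add_zero] at this
  · have h := hA.homogeneous.zeta_mul (r := r) 1
    simp only [one_mul, mul_zero, zeta_zero, one_smul] at h
    simp only [tensor, Matrix.mul_add, Matrix.add_mul, ← Matrix.mul_kronecker_mul, Matrix.one_mul,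
      Matrix.mul_one, hA.mul_E, h]

theorem IsHom.submatrix {M : BorelModule S} {N : BorelModule T} {A : Matrix T S ℂ}
    (hA : M.IsHom N A) {M' : BorelModule S'} {N' : BorelModule T'} (e : S' ≃ S) (f : T' ≃ T)
    (hM : M'.wt = M.wt ∘ e) (hN : N'.wt = N.wt ∘ f) (hM' : M'.E = M.E.submatrix e e)
    (hN' : N'.E = N.E.submatrix f f) : M'.IsHom N' (A.submatrix f e) := by
  refine ⟨fun b a h => ?_, ?_⟩
  · rw [hM, hN]
    exact hA.homogeneous _ _ h
  · rw [hM', hN', Matrix.submatrix_mul_equiv, Matrix.submatrix_mul_equiv, hA.mul_E]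

end BorelModule

/-! ### The modules of strands and of horizontal lines -/

/-- The module `V_α`. -/
def verma (r : ℕ) (α : ℂ) : BorelModule (Fin r) where
  wt := weight α
  E := opE r α
  wt_E b a h := by
    have e : (b : ℕ) + 1 = a := by
      by_contra hc
      exact h (if_neg hc)
    simp only [weight, ← e]
    push_cast
    ring

/-- The dual of `V_α`, where `E` acts by the transpose of `-E K⁻¹`. -/
def vermaDual (r : ℕ) (α : ℂ) : BorelModule (Fin r) where
  wt a := -weight α a
  E := Matrix.of fun k a => -(opE r α a k * zeta r (-weight α k))
  wt_E b a h := by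
    have e : (a : ℕ) + 1 = b := by
      by_contra hc
      exact h (by simp [opE, hc])
    simp only [weight, ← e]
    push_cast
    ring

/-- The module attached to a strand. -/
def strandModule {n : ℕ} (r : ℕ) (α : Fin n → ℂ) : Strand n → BorelModule (Fin r)
  | down i => verma r (α i)
  | up i => vermaDual r (α i)

/-- The module attached to a horizontal line. -/
def lineModule {n : ℕ} (r : ℕ) (α : Fin n → ℂ) :
    (w : List (Strand n)) → BorelModule (State r w)
  | [] => BorelModule.unit
  | x :: w => (strandModule r α x).tensor r (lineModule r α w)

open BorelModule

theorem IsHomogeneous.pow_opE (r : ℕ) (α : ℂ) (k : ℕ) :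
    IsHomogeneous (weight α) (weight α) (2 * k) (opE r α ^ k) := by
  induction k with
  | zero => simpa using isHomogeneous_one (weight (r := r) α)
  | succ k ih =>
    rw [pow_succ]
    have h := ih.mul (show IsHomogeneous (weight α) (weight α) 2 (opE r α) from (verma r α).wt_E)
    rwa [show (2 : ℂ) + 2 * k = 2 * (k + 1 : ℕ) by push_cast; ring] at h

theorem IsHomogeneous.pow_opF (r : ℕ) (α : ℂ) (k : ℕ) :
    IsHomogeneous (weight α) (weight α) (-2 * k) (opF r ^ k) := by
  have h1 : IsHomogeneous (weight (r := r) α) (weight α) (-2) (opF r) := by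
    intro b a h
    have e : (b : ℕ) = a + 1 := by
      by_contra hc
      exact h (if_neg hc)
    simp only [weight, e]
    push_cast
    ring
  induction k with
  | zero => simpa using isHomogeneous_one (weight (r := r) α)
  | succ k ih =>
    rw [pow_succ]
    have h := ih.mul h1
    rwa [show (-2 : ℂ) + -2 * k = -2 * (k + 1 : ℕ) by push_cast; ring] at h

theorem isHomogeneous_theta (r : ℕ) (c : ℕ → ℂ) (α β : ℂ) :
    IsHomogeneous ((verma r α).tensor r (verma r β)).wt ((verma r α).tensor r (verma r β)).wt 0
      (theta r c α) := by
  refine IsHomogeneous.sum _ fun k => IsHomogeneous.smul ?_ _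
  have := (IsHomogeneous.pow_opE r α k).kronecker (IsHomogeneous.pow_opF r β k)
  rwa [show (2 : ℂ) * k + -2 * k = 0 by ring] at this

theorem verma_tensor_swap_wt (r : ℕ) (α β : ℂ) :
    ((verma r β).tensor r (verma r α)).wt =
      ((verma r α).tensor r (verma r β)).wt ∘ Prod.swap := by
  funext p
  simp [tensor, add_comm]

theorem verma_tensor_E (r : ℕ) (α β : ℂ) :
    ((verma r α).tensor r (verma r β)).E = opE r α ⊗ₖ opK r 1 β + 1 ⊗ₖ opE r β := by
  simp only [tensor, verma, opK, one_mul]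

theorem verma_tensor_swap_E (r : ℕ) (α β : ℂ) :
    ((verma r β).tensor r (verma r α)).E =
      (opE r α ⊗ₖ 1 + opK r 1 α ⊗ₖ opE r β).submatrix Prod.swap Prod.swap := by
  rw [verma_tensor_E]
  ext ⟨a, b⟩ ⟨a', b'⟩
  simp only [Matrix.add_apply, Matrix.kroneckerMap_apply, Matrix.submatrix_apply, Prod.swap]
  ring

/-! ### Braidings, cups and caps as homomorphisms -/

theorem isHom_braiding {r : ℕ} (hr : 2 ≤ r) (α β : ℂ) :
    ((verma r α).tensor r (verma r β)).IsHom ((verma r β).tensor r (verma r α))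
      (braiding r α β) := by
  refine ⟨fun b a h => ?_, ?_⟩
  · rw [verma_tensor_swap_wt r α β]
    exact (((isHomogeneous_diagonal _ _).mul (isHomogeneous_theta r (rCoeff r) α β)) _ _ h).trans
      (by rw [add_zero (0 : ℂ)]; rfl)
  · rw [braiding, verma_tensor_swap_E r α β, verma_tensor_E]
    change _ = Matrix.submatrix _ (Equiv.prodComm _ _) (Equiv.prodComm _ _) *
      Matrix.submatrix _ (Equiv.prodComm _ _) _
    rw [Matrix.submatrix_mul_equiv, ← opR_mul hr]
    rfl

theorem isHom_braidingInv {r : ℕ} (hr : 2 ≤ r) (α β : ℂ) :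
    ((verma r α).tensor r (verma r β)).IsHom ((verma r β).tensor r (verma r α))
      (braidingInv r α β) := by
  refine ⟨fun b a h => ?_, ?_⟩
  · rw [verma_tensor_swap_wt r β α]
    exact (isHomogeneous_theta r (rInvCoeff r) β α).mul (isHomogeneous_diagonal _ _) _ _ h
      |>.trans (by rw [add_zero (0 : ℂ)]; rfl)
  · rw [braidingInv, verma_tensor_swap_E r β α, verma_tensor_E]
    change Matrix.submatrix _ _ (Equiv.prodComm _ _) *
      Matrix.submatrix _ (Equiv.prodComm _ _) (Equiv.prodComm _ _) = _
    rw [Matrix.submatrix_mul_equiv, opRInv_mul hr]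
    rfl

theorem isHom_unit_iff {S : Type} [Fintype S] (M : BorelModule S) (A : Matrix S Unit ℂ) :
    unit.IsHom M A ↔ (∀ a, A a () ≠ 0 → M.wt a = 0) ∧ M.E * A = 0 := by
  refine ⟨fun h => ⟨fun a ha => ?_, ?_⟩, fun h => ⟨fun a _ ha => ?_, ?_⟩⟩
  · simpa [unit] using h.homogeneous a () ha
  · rw [← h.mul_E, unit, Matrix.mul_zero]
  · simpa [unit] using h.1 a ha
  · rw [h.2, unit, Matrix.mul_zero]

theorem isHom_to_unit_iff {S : Type} [Fintype S] (M : BorelModule S) (A : Matrix Unit S ℂ) :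
    M.IsHom unit A ↔ (∀ a, A () a ≠ 0 → M.wt a = 0) ∧ A * M.E = 0 := by
  refine ⟨fun h => ⟨fun a ha => ?_, ?_⟩, fun h => ⟨fun _ a ha => ?_, ?_⟩⟩
  · simpa [unit, eq_comm] using h.homogeneous () a ha
  · rw [h.mul_E, unit, Matrix.zero_mul]
  · simpa [unit, eq_comm] using h.1 a ha
  · rw [h.2, unit, Matrix.zero_mul]

theorem isHom_cupR (r : ℕ) (α : ℂ) :
    unit.IsHom ((verma r α).tensor r (vermaDual r α))
      (Matrix.of fun (p : Fin r × Fin r) _ => if p.1 = p.2 then 1 else 0) := by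
  rw [isHom_unit_iff]
  refine ⟨fun a h => ?_, ?_⟩
  · have e : a.1 = a.2 := by
      by_contra hc
      exact h (if_neg hc)
    simp [tensor, verma, vermaDual, e]
  · ext ⟨a, b⟩ _
    simp only [tensor, verma, vermaDual, Matrix.mul_apply, Fintype.sum_prod_type, Matrix.add_apply,
      Matrix.kroneckerMap_apply, Matrix.of_apply, Matrix.diagonal_apply, Matrix.one_apply]
    simp [Finset.sum_add_distrib]

theorem isHom_capR (r : ℕ) (α : ℂ) :
    ((vermaDual r α).tensor r (verma r α)).IsHom unit
      (Matrix.of fun _ (p : Fin r × Fin r) => if p.1 = p.2 then 1 else 0) := by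
  rw [isHom_to_unit_iff]
  refine ⟨fun a h => ?_, ?_⟩
  · have e : a.1 = a.2 := by
      by_contra hc
      exact h (if_neg hc)
    simp [tensor, verma, vermaDual, e]
  · ext _ ⟨a, b⟩
    simp only [tensor, verma, vermaDual, Matrix.mul_apply, Fintype.sum_prod_type, Matrix.add_apply,
      Matrix.kroneckerMap_apply, Matrix.of_apply, Matrix.diagonal_apply, Matrix.one_apply]
    simp [mul_assoc, ← zeta_add, zeta_zero, Finset.sum_add_distrib]

/-- $K^{rk}$ commutes with $E$: the weights differ by $2$ and $\zeta_{2r}^{2rk}=1$. -/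
theorem opE_mul_zeta_weight (r : ℕ) (hr : r ≠ 0) (α : ℂ) (k : ℤ) (a b : Fin r) :
    opE r α a b * zeta r (r * k * weight α a) = opE r α a b * zeta r (r * k * weight α b) := by
  by_cases h : opE r α a b = 0
  · rw [h, zero_mul, zero_mul]
  · have e : weight α a = weight α b + 2 := (verma r α).wt_E a b h
    rw [e, ← zeta_add_period hr (r * k * weight α b) k]
    ring_nf

/-- Invariance of $\sum v_i^*\otimes K^sv_i$ amounts to $K^{s+1}$ commuting with $E$. For $s=r-1$
this is `opE_mul_zeta_weight` with $k=1$. -/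
theorem isHom_cupL (r : ℕ) (hr : r ≠ 0) (α : ℂ) :
    unit.IsHom ((vermaDual r α).tensor r (verma r α))
      (Matrix.of fun (p : Fin r × Fin r) _ => if p.1 = p.2 then eigK r α (r - 1) p.2 else 0) := by
  rw [isHom_unit_iff]
  refine ⟨fun a h => ?_, ?_⟩
  · have e : a.1 = a.2 := by
      by_contra hc
      exact h (if_neg hc)
    simp [tensor, verma, vermaDual, e]
  · ext ⟨a, b⟩ _
    simp only [tensor, verma, vermaDual, Matrix.mul_apply, Fintype.sum_prod_type, Matrix.add_apply,
      Matrix.kroneckerMap_apply, Matrix.of_apply, Matrix.diagonal_apply, Matrix.one_apply]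
    simp only [mul_ite, mul_zero, Finset.sum_ite_eq, Finset.mem_univ, if_true, ite_mul, one_mul,
      zero_mul, add_mul, Finset.sum_add_distrib, Matrix.zero_apply, eigK]
    have h := opE_mul_zeta_weight r hr α 1 b a
    rw [Int.cast_one, mul_one] at h
    have e1 : zeta r (weight α b) * zeta r ((r - 1) * weight α b) = zeta r (r * weight α b) := by
      rw [← zeta_add]; ring_nf
    have e2 : zeta r ((r - 1) * weight α a) = zeta r (r * weight α a) * zeta r (-weight α a) := by
      rw [← zeta_add]; ring_nf
    rw [mul_assoc, e1, e2]
    linear_combination (-zeta r (-weight α a)) * h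

theorem isHom_capL (r : ℕ) (hr : r ≠ 0) (α : ℂ) :
    ((verma r α).tensor r (vermaDual r α)).IsHom unit
      (Matrix.of fun _ (p : Fin r × Fin r) => if p.1 = p.2 then eigK r α (1 - r) p.1 else 0) := by
  rw [isHom_to_unit_iff]
  refine ⟨fun a h => ?_, ?_⟩
  · have e : a.1 = a.2 := by
      by_contra hc
      exact h (if_neg hc)
    simp [tensor, verma, vermaDual, e]
  · ext _ ⟨a, b⟩
    simp only [tensor, verma, vermaDual, Matrix.mul_apply, Fintype.sum_prod_type, Matrix.add_apply,
      Matrix.kroneckerMap_apply, Matrix.of_apply, Matrix.diagonal_apply, Matrix.one_apply]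
    simp only [mul_ite, mul_zero, ite_mul, one_mul, zero_mul, mul_add, Finset.sum_add_distrib,
      Matrix.zero_apply, eigK]
    simp only [Finset.sum_ite_eq, Finset.sum_ite_eq', Finset.mem_univ, if_true, Finset.sum_const_zero,
      Finset.sum_ite_irrel]
    have h := opE_mul_zeta_weight r hr α (-1) b a
    have e (x : ℂ) : zeta r (r * (-1 : ℤ) * x) = zeta r ((1 - r) * x) * zeta r (-x) := by
      rw [← zeta_add]
      push_cast
      ring_nf
    rw [e, e] at h
    linear_combination h

theorem BorelModule.IsHom.of_eq {S T : Type} [Fintype S] [Fintype T] {M : BorelModule S}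
    {N : BorelModule T} {A B : Matrix T S ℂ} (hA : M.IsHom N A) (h : ∀ b a, B b a = A b a) :
    M.IsHom N B := by
  rwa [show B = A from Matrix.ext h]

/-- A cup with further strands at its right is $A\otimes\mathrm{id}$, rewritten along the unit and
associativity bijections, since `State` brackets to the right. Strands at the left are added by
`Layer.skip`. -/
theorem BorelModule.IsHom.cup_lift {r : ℕ} {M N : BorelModule (Fin r)} {A : Matrix (Fin r × Fin r) Unit ℂ}
    (hA : unit.IsHom (M.tensor r N) A) {S : Type} [Fintype S] [DecidableEq S] (P : BorelModule S) :
    P.IsHom (M.tensor r (N.tensor r P))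
      ((A ⊗ₖ (1 : Matrix S S ℂ)).submatrix (Equiv.prodAssoc _ _ _).symm
        (Equiv.punitProd S).symm) :=
  (hA.tensor_one r P).submatrix _ _ (unit_tensor_wt r P) (tensor_assoc_wt r M N P)
    (unit_tensor_E r P) (tensor_assoc_E r M N P)

theorem BorelModule.IsHom.cap_lift {r : ℕ} {M N : BorelModule (Fin r)} {A : Matrix Unit (Fin r × Fin r) ℂ}
    (hA : (M.tensor r N).IsHom unit A) {S : Type} [Fintype S] [DecidableEq S] (P : BorelModule S) :
    (M.tensor r (N.tensor r P)).IsHom P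
      ((A ⊗ₖ (1 : Matrix S S ℂ)).submatrix (Equiv.punitProd S).symm
        (Equiv.prodAssoc _ _ _).symm) :=
  (hA.tensor_one r P).submatrix _ _ (tensor_assoc_wt r M N P) (unit_tensor_wt r P)
    (tensor_assoc_E r M N P) (unit_tensor_E r P)

theorem BorelModule.IsHom.crossing_lift {r : ℕ} {M N M' N' : BorelModule (Fin r)}
    {A : Matrix (Fin r × Fin r) (Fin r × Fin r) ℂ}
    (hA : (M.tensor r N).IsHom (M'.tensor r N') A) {S : Type} [Fintype S] [DecidableEq S]
    (P : BorelModule S) :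
    (M.tensor r (N.tensor r P)).IsHom (M'.tensor r (N'.tensor r P))
      ((A ⊗ₖ (1 : Matrix S S ℂ)).submatrix (Equiv.prodAssoc _ _ _).symm
        (Equiv.prodAssoc _ _ _).symm) :=
  (hA.tensor_one r P).submatrix _ _ (tensor_assoc_wt r M N P) (tensor_assoc_wt r M' N' P)
    (tensor_assoc_E r M N P) (tensor_assoc_E r M' N' P)

/-- The matrix of a layer is a homomorphism. -/
theorem Layer.isHom_matrix {n r : ℕ} (hr : 2 ≤ r) (α : Fin n → ℂ) {v w : List (Strand n)}
    (s : Layer n v w) : (lineModule r α v).IsHom (lineModule r α w) (s.matrix r α) := by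
  induction s with
  | pos i j w =>
    exact ((isHom_braiding hr (α i) (α j)).crossing_lift (lineModule r α w)).of_eq fun ⟨b', a', t⟩ ⟨a, b, s⟩ => by
      simp [Layer.matrix, Matrix.one_apply]
      rfl
  | neg i j w =>
    exact ((isHom_braidingInv hr (α i) (α j)).crossing_lift (lineModule r α w)).of_eq fun ⟨b', a', t⟩ ⟨a, b, s⟩ => by
      simp [Layer.matrix, Matrix.one_apply]
      rfl
  | cupR i w =>
    exact ((isHom_cupR r (α i)).cup_lift (lineModule r α w)).of_eq fun ⟨b', a', t⟩ s => by
      simp [Layer.matrix, Matrix.one_apply, ite_and]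
      rfl
  | cupL i w =>
    exact ((isHom_cupL r (by omega) (α i)).cup_lift (lineModule r α w)).of_eq fun ⟨b', a', t⟩ s => by
      simp [Layer.matrix, Matrix.one_apply, ite_and]
      rfl
  | capR i w =>
    exact ((isHom_capR r (α i)).cap_lift (lineModule r α w)).of_eq fun s ⟨b', a', t⟩ => by
      simp [Layer.matrix, Matrix.one_apply, ite_and]
      rfl
  | capL i w =>
    exact ((isHom_capL r (by omega) (α i)).cap_lift (lineModule r α w)).of_eq fun s ⟨b', a', t⟩ => by
      simp [Layer.matrix, Matrix.one_apply, ite_and]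
      rfl
  | skip x s ih =>
    exact (ih.one_tensor r (strandModule r α x)).of_eq fun ⟨a', t'⟩ ⟨a, t⟩ => by
      simp [Layer.matrix, Matrix.one_apply]
      rfl

/-- The matrix of a diagram is a homomorphism. -/
theorem Diagram.isHom_matrix {n r : ℕ} (hr : 2 ≤ r) (α : Fin n → ℂ) {v w : List (Strand n)}
    (D : Diagram n v w) : (lineModule r α v).IsHom (lineModule r α w) (D.matrix r α) := by
  induction D with
  | nil v => exact IsHom.one _
  | cons s D ih => exact ih.mul (s.isHom_matrix hr α)

/-- The matrix of a diagram factors through the module of each horizontal line. -/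
theorem Diagram.exists_matrix_eq_mul {n r : ℕ} (hr : 2 ≤ r) (α : Fin n → ℂ)
    {v w : List (Strand n)} (D : Diagram n v w) {l : List (Strand n)} (hl : l ∈ D.lines) :
    ∃ (A : Matrix (State r w) (State r l) ℂ) (B : Matrix (State r l) (State r v) ℂ),
      (lineModule r α l).IsHom (lineModule r α w) A ∧
      (lineModule r α v).IsHom (lineModule r α l) B ∧ D.matrix r α = A * B := by
  induction D with
  | nil v =>
    obtain rfl := List.mem_singleton.1 hl
    exact ⟨1, 1, IsHom.one _, IsHom.one _, by rw [Diagram.matrix, one_mul]⟩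
  | cons s D ih =>
    rcases List.mem_cons.1 hl with rfl | hl
    · exact ⟨_, 1, (Diagram.cons s D).isHom_matrix hr α, IsHom.one _, by rw [Matrix.mul_one]⟩
    · obtain ⟨A, B, hA, hB, h⟩ := ih hl
      exact ⟨A, B * s.matrix r α, hA, hB.mul (s.isHom_matrix hr α), by
        rw [Diagram.matrix, h, Matrix.mul_assoc]⟩

/-! ### Contractions -/

/-- The iterated twisted commutator of `h` with `E`. -/
def twistedAd {S : Type} [Fintype S] (E : Matrix S S ℂ) (l : List ℂ) (h : Matrix S S ℂ) :
    Matrix S S ℂ :=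
  l.foldr (fun s g => E * g - s • (g * E)) h

theorem twistedAd_cons {S : Type} [Fintype S] (E : Matrix S S ℂ) (s : ℂ) (l : List ℂ)
    (h : Matrix S S ℂ) :
    twistedAd E (s :: l) h = E * twistedAd E l h - s • (twistedAd E l h * E) := rfl

/-- The maps $g\mapsto Eg-s\,gE$ are combinations of left and right multiplication by $E$, so they
commute with each other. -/
theorem twistedAd_perm {S : Type} [Fintype S] (E : Matrix S S ℂ) {l l' : List ℂ}
    (p : l.Perm l') (h : Matrix S S ℂ) : twistedAd E l h = twistedAd E l' h := by
  refine p.foldr_eq' (fun s _ t _ g => ?_) h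
  simp only [Matrix.mul_sub, Matrix.sub_mul, Matrix.mul_smul, Matrix.smul_mul, smul_sub,
    Matrix.mul_assoc, smul_smul, mul_comm s t]
  abel

/-- On a vector killed by $E$ the terms ending in $E$ disappear, and each commutator contributes
only a left factor $E$. -/
theorem twistedAd_mulVec {S : Type} [Fintype S] [DecidableEq S] (E : Matrix S S ℂ) (l : List ℂ)
    (h : Matrix S S ℂ) {x : S → ℂ} (hx : E.mulVec x = 0) :
    (twistedAd E l h).mulVec x = (E ^ l.length).mulVec (h.mulVec x) := by
  induction l with
  | nil => simp [twistedAd]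
  | cons s l ih =>
    rw [twistedAd_cons, Matrix.sub_mulVec, Matrix.smul_mulVec, ← Matrix.mulVec_mulVec,
      ← Matrix.mulVec_mulVec, hx, Matrix.mulVec_zero, smul_zero, sub_zero, ih, List.length_cons,
      pow_succ', Matrix.mulVec_mulVec, Matrix.mulVec_mulVec]

/-- The powers `p, p², …, p ^ (r - 1)`. -/
def powers (r : ℕ) (p : ℂ) : List ℂ := (List.range (r - 1)).map fun j => p ^ (j + 1)

/-- The fold starts with the last twist $p^{r-1}$, which takes $f_{r-1}$ to $f_{r-2}$; the last
step, with twist $p$, takes $f_1$ to $f_0$. -/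
theorem twistedAd_powers {r : ℕ} {S : Type} [Fintype S] (E : Matrix S S ℂ) (p : ℂ)
    (f : ℕ → Matrix S S ℂ)
    (hf : ∀ j, j + 1 < r → f j = E * f (j + 1) - p ^ (j + 1) • (f (j + 1) * E)) :
    twistedAd E (powers r p) (f (r - 1)) = f 0 := by
  have key : ∀ k ≤ r - 1, twistedAd E ((List.range k).map fun j => p ^ (j + 1)) (f k) = f 0 := by
    intro k
    induction k with
    | zero => intro _; rfl
    | succ k ih =>
      intro hk
      rw [List.range_succ, List.map_append, twistedAd, List.foldr_append]
      change twistedAd E _ (E * f (k + 1) - p ^ (k + 1) • (f (k + 1) * E)) = _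
      rw [← hf k (by omega)]
      exact ih (by omega)
  exact key _ le_rfl

/-- $p^{-i}=p^{r-i}$, so inverting $p$ reverses the list. -/
theorem powers_inv_perm {r : ℕ} {p : ℂ} (hp : p ^ r = 1) :
    (powers r p⁻¹).Perm (powers r p) := by
  have h0 : p ≠ 0 ∨ r = 0 := by
    by_contra! h
    rw [h.1, zero_pow h.2] at hp
    exact zero_ne_one hp
  have : powers r p⁻¹ = (powers r p).reverse := by
    refine List.ext_getElem (by simp [powers]) fun i h1 h2 => ?_
    simp only [powers, List.length_map, List.length_range] at h1
    have h0 : p ≠ 0 := h0.resolve_right (by omega)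
    simp only [powers, List.getElem_map, List.getElem_range, List.getElem_reverse, List.length_map,
      List.length_range, inv_pow]
    rw [inv_eq_iff_eq_inv, eq_comm, inv_eq_iff_eq_inv, eq_comm, ← mul_left_inj'
      (pow_ne_zero (i + 1) h0), ← pow_add, show r - 1 - 1 - i + 1 + (i + 1) = r by omega, hp,
      inv_mul_cancel₀ (pow_ne_zero _ h0)]
  rw [this]
  exact List.reverse_perm _

/-- The module is contractible, that is, the identity is an iterated twisted commutator of a
homogeneous operator with `E`. -/
def BorelModule.Contractible (r : ℕ) {S : Type} [Fintype S] [DecidableEq S] (M : BorelModule S) :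
    Prop :=
  ∃ h : Matrix S S ℂ, IsHomogeneous M.wt M.wt (-2 * (r - 1 : ℕ)) h ∧
    twistedAd M.E (powers r (zeta r (-2))) h = 1

theorem zeta_neg_two_pow {r : ℕ} (hr : r ≠ 0) : zeta r (-2) ^ r = 1 := by
  rw [← zeta_nat_mul, ← zeta_period hr (-1)]
  push_cast
  ring_nf

/-- If `M` is contractible, so is each module `X ⊗ M`. -/
theorem BorelModule.Contractible.tensor_left {r : ℕ} {S T : Type} [Fintype S] [DecidableEq S]
    [Fintype T] [DecidableEq T] {M : BorelModule T} (hM : M.Contractible r) (X : BorelModule S) :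
    (X.tensor r M).Contractible r := by
  obtain ⟨h, hh, h1⟩ := hM
  refine ⟨1 ⊗ₖ h, ?_, ?_⟩
  · have := (isHomogeneous_one X.wt).kronecker hh
    rwa [zero_add] at this
  -- After the twists $p^{r-1},\dots,p^{k+1}$, with $p=\zeta_{2r}^{-2}$, the operator on $M$ has
  -- degree $-2k$. For $g$ of degree $-2(k+1)$ one has $Kg=p^{k+1}gK$, so the commutator of
  -- $1\otimes g$ with twist $p^{k+1}$ has no component along $E_X$. This dictates the choice of the
  -- twists.
  · have key : ∀ (k l : ℕ), k + l = r - 1 →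
        IsHomogeneous M.wt M.wt (-2 * k) (twistedAd M.E
          ((List.range' k l).map fun j => zeta r (-2) ^ (j + 1)) h) ∧
        twistedAd (X.tensor r M).E ((List.range' k l).map fun j => zeta r (-2) ^ (j + 1))
          (1 ⊗ₖ h) = 1 ⊗ₖ twistedAd M.E ((List.range' k l).map fun j => zeta r (-2) ^ (j + 1)) h := by
      intro k l
      induction l generalizing k with
      | zero =>
        intro hk
        rw [add_zero] at hk
        exact ⟨hk ▸ hh, rfl⟩
      | succ l ih =>
        intro hk
        obtain ⟨i1, i2⟩ := ih (k + 1) (by omega)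
        rw [List.range'_succ, List.map_cons, twistedAd_cons, twistedAd_cons, i2]
        set g := twistedAd M.E ((List.range' (k + 1) l).map fun j => zeta r (-2) ^ (j + 1)) h
        have hE : IsHomogeneous M.wt M.wt 2 M.E := M.wt_E
        refine ⟨?_, ?_⟩
        · rw [sub_eq_add_neg, ← neg_smul]
          refine IsHomogeneous.add ?_ (IsHomogeneous.smul ?_ _)
          · have := hE.mul i1
            rwa [show -2 * ((k + 1 : ℕ) : ℂ) + 2 = -2 * k by push_cast; ring] at this
          · have := i1.mul hE
            rwa [show 2 + -2 * ((k + 1 : ℕ) : ℂ) = -2 * k by push_cast; ring] at this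
        · have hz := i1.zeta_mul (r := r) 1
          simp only [one_mul] at hz
          rw [mul_comm (-2 : ℂ), zeta_nat_mul] at hz
          simp only [tensor, Matrix.add_mul, Matrix.mul_add, ← Matrix.mul_kronecker_mul,
            Matrix.one_mul, Matrix.mul_one, hz, smul_add, Matrix.kronecker_smul]
          ext a b
          simp only [Matrix.add_apply, Matrix.sub_apply, Matrix.smul_apply,
            Matrix.kroneckerMap_apply, smul_eq_mul]
          ring
    have h2 := (key 0 (r - 1) (by omega)).2
    rw [← List.range_eq_range'] at h2
    rw [powers, h2]
    rw [powers] at h1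
    rw [h1, Matrix.one_kronecker_one]

/-- If `E` has twisted antiderivatives of the identity on `X`, each module `X ⊗ M` is
contractible. -/
theorem BorelModule.contractible_tensor {r : ℕ} (hr : r ≠ 0) {S T : Type} [Fintype S]
    [DecidableEq S] [Fintype T] [DecidableEq T] (X : BorelModule S) (M : BorelModule T)
    (f : ℕ → Matrix S S ℂ) (hf : IsHomogeneous X.wt X.wt (-2 * (r - 1 : ℕ)) (f (r - 1)))
    (hf0 : f 0 = 1) (hfE : ∀ j, j + 1 < r →
      f j = X.E * f (j + 1) - (zeta r (-2))⁻¹ ^ (j + 1) • (f (j + 1) * X.E)) :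
    (X.tensor r M).Contractible r := by
  -- The antiderivatives on $X\otimes M$ are $f_j\otimes K^{-j}$. Moving $E_M$ across $K^{-(j+1)}$
  -- costs $p^{j+1}$, with $p=\zeta_{2r}^{-2}$, which cancels the twist $p^{-(j+1)}$. So the terms
  -- in $E_M$ drop out and $K\cdot K^{-(j+1)}=K^{-j}$ remains.
  refine ⟨f (r - 1) ⊗ₖ Matrix.diagonal (fun t => zeta r (-(r - 1 : ℕ) * M.wt t)), ?_, ?_⟩
  · have := hf.kronecker (isHomogeneous_diagonal M.wt fun t => zeta r (-(r - 1 : ℕ) * M.wt t))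
    rwa [add_zero] at this
  -- The construction uses the powers of $p^{-1}$ and `Contractible` those of $p$; they agree up to
  -- order.
  · rw [← twistedAd_perm _ (powers_inv_perm (zeta_neg_two_pow hr)), twistedAd_powers _ _
      fun j => f j ⊗ₖ Matrix.diagonal (fun t => zeta r (-(j : ℂ) * M.wt t))]
    · simp [hf0, zeta_zero]
    · intro j hj
      have hE : IsHomogeneous M.wt M.wt 2 M.E := M.wt_E
      have hz := hE.zeta_mul (r := r) (-((j + 1 : ℕ) : ℂ))
      have e1 : zeta r (-((j + 1 : ℕ) : ℂ) * 2) = zeta r (-2) ^ (j + 1) := by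
        rw [← zeta_nat_mul]
        ring_nf
      have e2 : (Matrix.diagonal fun t => zeta r (M.wt t)) *
          (Matrix.diagonal fun t => zeta r (-((j + 1 : ℕ) : ℂ) * M.wt t)) =
          Matrix.diagonal fun t => zeta r (-(j : ℂ) * M.wt t) := by
        rw [Matrix.diagonal_mul_diagonal]
        congr 1
        funext t
        rw [← zeta_add]
        push_cast
        ring_nf
      have e3 : (Matrix.diagonal fun t => zeta r (-((j + 1 : ℕ) : ℂ) * M.wt t)) *
          (Matrix.diagonal fun t => zeta r (M.wt t)) =
          Matrix.diagonal fun t => zeta r (-(j : ℂ) * M.wt t) := by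
        rw [← e2, Matrix.diagonal_mul_diagonal, Matrix.diagonal_mul_diagonal]
        simp only [mul_comm]
      have hp := pow_ne_zero (j + 1) (zeta_ne_zero r (-2))
      simp only [tensor, Matrix.add_mul, Matrix.mul_add, ← Matrix.mul_kronecker_mul,
        Matrix.one_mul, Matrix.mul_one, hz, e1, e2, e3, hfE j hj, smul_add, Matrix.kronecker_smul,
        smul_smul, inv_pow, inv_mul_cancel₀ hp, one_smul]
      ext a b
      simp only [Matrix.add_apply, Matrix.sub_apply, Matrix.smul_apply,
        Matrix.kroneckerMap_apply, smul_eq_mul]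
      ring

/-- The Gaussian binomial coefficient `(a + j choose j)` at `p`. -/
def gauss (p : ℂ) (j a : ℕ) : ℂ := ∏ i ∈ Finset.range j, (1 - p ^ (a + i + 1)) / (1 - p ^ (i + 1))

theorem gauss_succ (p : ℂ) (j a : ℕ) :
    gauss p (j + 1) a = gauss p j a * ((1 - p ^ (a + j + 1)) / (1 - p ^ (j + 1))) :=
  Finset.prod_range_succ _ _

/-- The absorption identity $\binom{a+j+1}{j+1}[j+1]=\binom{a+j+1}{j}[a+1]$ for Gaussian binomials.
-/
theorem gauss_succ_pred (p : ℂ) (j a : ℕ) (hp : ∀ i ≤ j, 1 - p ^ (i + 1) ≠ 0) :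
    gauss p (j + 1) a * (1 - p ^ (j + 1)) = gauss p j (a + 1) * (1 - p ^ (a + 1)) := by
  induction j with
  | zero =>
    have := hp 0 le_rfl
    rw [gauss_succ, mul_assoc, add_zero, div_mul_cancel₀ _ this]
    simp [gauss]
  | succ j ih =>
    have h1 := hp (j + 1) le_rfl
    have h2 := hp j (by omega)
    rw [gauss_succ p (j + 1), gauss_succ p j (a + 1)]
    have := ih fun i hi => hp i (by omega)
    rw [mul_assoc, div_mul_cancel₀ _ h1]
    field_simp
    rw [show a + (j + 1) + 1 = a + 1 + j + 1 by ring]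
    linear_combination (1 - p ^ (a + 1 + j + 1)) * this

theorem gauss_pascal (p : ℂ) (j a : ℕ) (hp : ∀ i ≤ j, 1 - p ^ (i + 1) ≠ 0) :
    gauss p j (a + 1) = gauss p (j + 1) (a + 1) - p ^ (j + 1) * gauss p (j + 1) a := by
  have h1 := hp j le_rfl
  have h2 := gauss_succ_pred p j a hp
  have h3 := gauss_succ p j (a + 1)
  rw [← mul_left_inj' h1, sub_mul, mul_assoc, h2, h3, mul_assoc, div_mul_cancel₀ _ h1]
  ring

theorem gauss_zero_right (p : ℂ) (j : ℕ) (hp : ∀ i < j, 1 - p ^ (i + 1) ≠ 0) :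
    gauss p j 0 = 1 :=
  Finset.prod_eq_one fun i hi => by
    rw [zero_add, div_self (hp i (Finset.mem_range.1 hi))]

/-- The twisted antiderivatives of the identity for a shift with nonzero entries. -/
def antiderivative (r : ℕ) (ε : ℕ → ℂ) (p : ℂ) (j : ℕ) : Matrix (Fin r) (Fin r) ℂ :=
  Matrix.of fun b a => if (b : ℕ) = a + j then
    gauss p j a / ∏ i ∈ Finset.range j, ε (a + i + 1) else 0

theorem antiderivative_zero (r : ℕ) (ε : ℕ → ℂ) (p : ℂ) : antiderivative r ε p 0 = 1 := by
  ext b a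
  simp [antiderivative, gauss, Matrix.one_apply, Fin.ext_iff]

theorem shiftDown_mul_apply (r : ℕ) (ε : ℕ → ℂ) (A : Matrix (Fin r) (Fin r) ℂ) (b a : Fin r) :
    (shiftDown r ε * A) b a = if h : (b : ℕ) + 1 < r then ε (b + 1) * A ⟨b + 1, h⟩ a else 0 := by
  rw [Matrix.mul_apply]
  split_ifs with h
  · rw [Finset.sum_eq_single ⟨b + 1, h⟩]
    · simp [shiftDown]
    · intro k _ hk
      rw [shiftDown, Matrix.of_apply, if_neg fun h => hk (Fin.ext h.symm), zero_mul]
    · simp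
  · refine Finset.sum_eq_zero fun k _ => ?_
    rw [shiftDown, Matrix.of_apply, if_neg (by omega), zero_mul]

theorem mul_shiftDown_apply (r : ℕ) (ε : ℕ → ℂ) (A : Matrix (Fin r) (Fin r) ℂ) (b a : Fin r) :
    (A * shiftDown r ε) b a =
      if (a : ℕ) = 0 then 0 else A b ⟨a - 1, by omega⟩ * ε a := by
  rw [Matrix.mul_apply]
  split_ifs with h
  · refine Finset.sum_eq_zero fun k _ => ?_
    rw [shiftDown, Matrix.of_apply, if_neg (by omega), mul_zero]
  · rw [Finset.sum_eq_single ⟨a - 1, by omega⟩]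
    · rw [shiftDown, Matrix.of_apply, if_pos (by simp only; omega)]
    · intro k _ hk
      rw [shiftDown, Matrix.of_apply, if_neg fun h => hk (Fin.ext (by simp only; omega)), mul_zero]
    · simp

/-- Once the products of the $\varepsilon$ are cancelled, the entries satisfy Pascal's rule
`gauss_pascal`. Away from the two ends of the basis nothing else is needed; at the upper end $p^r=1$
enters. -/
theorem antiderivative_succ {r : ℕ} (ε : ℕ → ℂ) (hε : ∀ i, 0 < i → i < r → ε i ≠ 0) {p : ℂ}
    (hp : IsPrimitiveRoot p r) (j : ℕ) (hj : j + 1 < r) :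
    antiderivative r ε p j = shiftDown r ε * antiderivative r ε p (j + 1) -
      p ^ (j + 1) • (antiderivative r ε p (j + 1) * shiftDown r ε) := by
  have hp' : ∀ i ≤ j, 1 - p ^ (i + 1) ≠ 0 := fun i hi h =>
    hp.pow_ne_one_of_pos_of_lt (Nat.succ_ne_zero i) (by omega) (sub_eq_zero.1 h).symm
  ext b a
  rw [Matrix.sub_apply, Matrix.smul_apply, shiftDown_mul_apply, mul_shiftDown_apply, smul_eq_mul]
  simp only [antiderivative, Matrix.of_apply]
  by_cases hb : (b : ℕ) = a + j
  swap
  · rw [if_neg hb]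
    split_ifs <;> first | omega | simp
  have h1 : (if h : (b : ℕ) + 1 < r then ε (b + 1) * (if (b : ℕ) + 1 = a + (j + 1) then
      gauss p (j + 1) a / ∏ i ∈ Finset.range (j + 1), ε (a + i + 1) else 0) else 0) =
      gauss p (j + 1) a / ∏ i ∈ Finset.range j, ε (a + i + 1) := by
    split_ifs with h2 h3
    · have h4 := hε (b + 1) (by omega) h2
      rw [Finset.prod_range_succ, ← hb, mul_comm, div_mul_eq_mul_div, mul_div_mul_right _ _ h4]
    · omega
    -- Here $a+j=r-1$, and $E f_{j+1}$ has no entry in the last row. The expected coefficient is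
    -- zero too, since it contains the factor $1-p^{a+j+1}=1-p^r$.
    · rw [gauss_succ, show (a : ℕ) + j + 1 = r by omega, hp.pow_eq_one]
      simp
  rw [h1, if_pos hb]
  split_ifs with h2 h3
  -- At $a=0$ the term $f_{j+1}E$ is absent, and both Gaussian coefficients equal $1$.
  · have hp0 : ∀ i < j + 1, 1 - p ^ (i + 1) ≠ 0 := fun i hi => hp' i (by omega)
    rw [h2, gauss_zero_right _ _ hp0, gauss_zero_right _ _ fun i hi => hp0 i (by omega), mul_zero,
      sub_zero]
  · obtain ⟨a', ha'⟩ : ∃ a', (a : ℕ) = a' + 1 := ⟨a - 1, by omega⟩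
    have h4 := hε a (by omega) a.2
    simp only [ha', Nat.add_sub_cancel] at h4 ⊢
    rw [Finset.prod_range_succ', add_zero, div_mul_eq_mul_div, mul_div_mul_right _ _ h4,
      gauss_pascal p j a' hp', sub_div, mul_div]
    congr 2
    exact Finset.prod_congr rfl fun i _ => by congr 1; ring
  · omega

theorem isPrimitiveRoot_zeta_two {r : ℕ} (hr : r ≠ 0) : IsPrimitiveRoot (zeta r 2) r := by
  have : zeta r 2 = Complex.exp (2 * Real.pi * Complex.I / r) := by
    rw [zeta]
    congr 1
    ring
  rw [this]
  exact Complex.isPrimitiveRoot_exp r hr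

/-- The eigenvalues of `E` on `V_α` are not zero if `α` is not an integer. -/
theorem opE_coeff_ne_zero {r : ℕ} (hr : 2 ≤ r) {α : ℂ} (hα : α ∉ integers) (i : ℕ) :
    (zeta r (α - i + 1) - zeta r (-(α - i + 1))) / (zeta r 1 - zeta r (-1)) ≠ 0 := by
  refine div_ne_zero (fun h => hα ?_) (zeta_one_sub_ne_zero hr)
  obtain ⟨k, hk⟩ := (zeta_sub_zeta_neg_eq_zero_iff (by omega) _).1 h
  refine ⟨r * k + i - 1, ?_⟩
  push_cast
  linear_combination -hk

/-- Modules `V_α ⊗ M` are contractible if `α` is not an integer. -/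
theorem contractible_verma_tensor {r : ℕ} (hr : 2 ≤ r) {α : ℂ} (hα : α ∉ integers) {T : Type}
    [Fintype T] [DecidableEq T] (M : BorelModule T) : ((verma r α).tensor r M).Contractible r := by
  have hz : (zeta r (-2))⁻¹ = zeta r 2 := by rw [zeta_neg, inv_inv]
  refine contractible_tensor (by omega) _ M (antiderivative r (fun i =>
    (zeta r (α - i + 1) - zeta r (-(α - i + 1))) / (zeta r 1 - zeta r (-1))) (zeta r 2))
    (fun b a h => ?_) (antiderivative_zero r _ _) fun j hj => ?_
  · have e : (b : ℕ) = a + (r - 1) := by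
      by_contra hc
      exact h (if_neg hc)
    simp only [verma, weight, e]
    push_cast
    ring
  · rw [hz]
    exact antiderivative_succ _ (fun i _ _ => opE_coeff_ne_zero hr hα i)
      (isPrimitiveRoot_zeta_two (by omega)) j hj

/-- Modules `V_α^* ⊗ M` are contractible if `α` is not an integer. -/
theorem contractible_vermaDual_tensor {r : ℕ} (hr : 2 ≤ r) {α : ℂ} (hα : α ∉ integers) {T : Type}
    [Fintype T] [DecidableEq T] (M : BorelModule T) :
    ((vermaDual r α).tensor r M).Contractible r := by
  have hz : (zeta r (-2))⁻¹ = zeta r 2 := by rw [zeta_neg, inv_inv]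
  -- On the dual, $E$ maps $v_a^*$ to a multiple of $v_{a+1}^*$. Reversing the basis makes it a
  -- downward shift again; the index $i$ stands for $v_{r-1-i}^*$.
  set ε : ℕ → ℂ := fun i => -((zeta r (α - (r - i : ℕ) + 1) - zeta r (-(α - (r - i : ℕ) + 1))) /
    (zeta r 1 - zeta r (-1)) * zeta r (-(α - 2 * (r - 1 - i + 1 : ℕ)))) with hε
  have hE : (vermaDual r α).E = (shiftDown r ε).submatrix Fin.revPerm Fin.revPerm := by
    ext k a
    simp only [vermaDual, opE, shiftDown, Matrix.of_apply, Matrix.submatrix_apply, weight,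
      Fin.revPerm_apply, Fin.val_rev, hε]
    by_cases h : (a : ℕ) + 1 = k
    · rw [if_pos h, if_pos (by omega), show r - (r - ((a : ℕ) + 1)) = k by omega,
        show r - 1 - (r - ((a : ℕ) + 1)) + 1 = k by omega]
    · rw [if_neg h, if_neg (by omega)]
      simp
  refine contractible_tensor (by omega) _ M
    (fun j => (antiderivative r ε (zeta r 2) j).submatrix Fin.revPerm Fin.revPerm)
    (fun b a h => ?_) ?_ fun j hj => ?_
  · have e : (Fin.rev b : ℕ) = Fin.rev a + (r - 1) := by
      by_contra hc
      exact h (if_neg hc)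
    have e' : (a : ℕ) = b + (r - 1) := by
      simp only [Fin.val_rev] at e
      omega
    simp only [vermaDual, weight, e']
    push_cast
    ring
  · simp only [antiderivative_zero, Matrix.submatrix_one_equiv]
  · rw [hz, hE, Matrix.submatrix_mul_equiv, Matrix.submatrix_mul_equiv, antiderivative_succ ε
      (fun i _ _ => neg_ne_zero.2 (mul_ne_zero (opE_coeff_ne_zero hr hα _) (zeta_ne_zero r _)))
      (isPrimitiveRoot_zeta_two (by omega)) j hj]
    rfl

/-- The module of a horizontal line is contractible if the colour of one of its strands is not an
integer. -/
theorem contractible_lineModule {n r : ℕ} (hr : 2 ≤ r) (α : Fin n → ℂ) {w : List (Strand n)}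
    {x : Strand n} (hx : x ∈ w) (hα : α x.comp ∉ integers) : (lineModule r α w).Contractible r := by
  induction w with
  | nil => exact absurd hx List.not_mem_nil
  | cons y w ih =>
    rcases List.mem_cons.1 hx with rfl | hx
    · cases x with
      | down i => exact contractible_verma_tensor hr hα (lineModule r α w)
      | up i => exact contractible_vermaDual_tensor hr hα (lineModule r α w)
    · exact (ih hx).tensor_left (strandModule r α y)

/-- A homomorphism through a contractible module kills each vector killed by `E`, if
`E ^ (r - 1)` is zero on the target. -/
theorem BorelModule.Contractible.mulVec_eq_zero {r : ℕ} {S T U : Type} [Fintype S] [Fintype T]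
    [Fintype U] [DecidableEq S] [DecidableEq T] [DecidableEq U] {L : BorelModule S}
    {M : BorelModule T} {N : BorelModule U} (hM : M.Contractible r) {A : Matrix U T ℂ}
    {B : Matrix T S ℂ} (hA : M.IsHom N A) (hB : L.IsHom M B) (hN : N.E ^ (r - 1) = 0)
    {x : S → ℂ} (hx : L.E.mulVec x = 0) : (A * B).mulVec x = 0 := by
  obtain ⟨h, -, h1⟩ := hM
  have hBx : M.E.mulVec (B.mulVec x) = 0 := by
    rw [Matrix.mulVec_mulVec, ← hB.mul_E, ← Matrix.mulVec_mulVec, hx, Matrix.mulVec_zero]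
  -- As $EBx=0$ and the twisted commutator is the identity, $Bx=E^{r-1}hBx$. Then $A$ moves past
  -- $E^{r-1}$, which vanishes on $N$.
  have h2 := twistedAd_mulVec M.E (powers r (zeta r (-2))) h hBx
  have h3 : ∀ k, A * M.E ^ k = N.E ^ k * A := by
    intro k
    induction k with
    | zero => simp
    | succ k ih => rw [pow_succ, ← Matrix.mul_assoc, ih, Matrix.mul_assoc, hA.mul_E,
        ← Matrix.mul_assoc, pow_succ]
  rw [h1, Matrix.one_mulVec] at h2
  rw [← Matrix.mulVec_mulVec, h2, Matrix.mulVec_mulVec, powers, List.length_map, List.length_range,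
    h3, hN, Matrix.zero_mul, Matrix.zero_mulVec]

/-! ### The scalar of a (1,1)-tangle -/

theorem verma_wt_eq {n r : ℕ} (α : Fin n → ℂ) (c : Fin n) :
    (verma r (α c)).wt = (lineModule r α [down c]).wt ∘ (Equiv.prodPUnit (Fin r)).symm := by
  funext a
  simp [lineModule, tensor, strandModule, unit]
  rfl

theorem verma_E_eq {n r : ℕ} (α : Fin n → ℂ) (c : Fin n) :
    (verma r (α c)).E = (lineModule r α [down c]).E.submatrix (Equiv.prodPUnit (Fin r)).symm
      (Equiv.prodPUnit (Fin r)).symm := by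
  ext a b
  change opE r (α c) a b = opE r (α c) a b * Matrix.diagonal (fun _ : Unit => zeta r 0) () () +
    (1 : Matrix (Fin r) (Fin r) ℂ) a b * (0 : Matrix Unit Unit ℂ) () ()
  simp [zeta_zero]

/-- The endomorphism of `V_{α_c}` attached to a (1,1)-tangle. -/
def Diagram.endo {n : ℕ} (r : ℕ) {c : Fin n} (T : Diagram n [down c] [down c]) (α : Fin n → ℂ) :
    Matrix (Fin r) (Fin r) ℂ :=
  Matrix.of fun b a => T.matrix r α (b, ()) (a, ())

theorem Diagram.isHom_endo {n r : ℕ} (hr : 2 ≤ r) {c : Fin n} (T : Diagram n [down c] [down c])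
    (α : Fin n → ℂ) : (verma r (α c)).IsHom (verma r (α c)) (T.endo r α) :=
  (T.isHom_matrix hr α).submatrix (Equiv.prodPUnit (Fin r)).symm (Equiv.prodPUnit (Fin r)).symm
    (verma_wt_eq α c) (verma_wt_eq α c) (verma_E_eq α c) (verma_E_eq α c)

/-- The value of a (1,1)-tangle on the highest weight vector. -/
def Diagram.corner {n : ℕ} (r : ℕ) [NeZero r] {c : Fin n} (T : Diagram n [down c] [down c])
    (α : Fin n → ℂ) : ℂ := T.endo r α 0 0

/-- For a diagonal matrix, commuting with the shift says that consecutive diagonal entries agree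
after multiplication by a nonzero $\varepsilon_i$. -/
theorem eq_smul_one_of_commute {r : ℕ} [NeZero r] {ε : ℕ → ℂ} (hε : ∀ i, ε i ≠ 0)
    {A : Matrix (Fin r) (Fin r) ℂ} (hA : ∀ b a, A b a ≠ 0 → b = a)
    (h : A * shiftDown r ε = shiftDown r ε * A) : A = A 0 0 • 1 := by
  have key : ∀ (i : ℕ) (hi : i < r), A ⟨i, hi⟩ ⟨i, hi⟩ = A 0 0 := by
    intro i
    induction i with
    | zero => intro _; rfl
    | succ i ih =>
      intro hi
      have h1 := congrFun (congrFun h ⟨i, by omega⟩) ⟨i + 1, hi⟩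
      rw [mul_shiftDown_apply, shiftDown_mul_apply, dif_pos (by simpa using hi), if_neg (by simp),
        mul_comm] at h1
      rw [← ih (by omega)]
      exact (mul_left_cancel₀ (hε _) h1).symm
  ext b a
  rw [Matrix.smul_apply, smul_eq_mul, Matrix.one_apply]
  split_ifs with hba
  · rw [hba, mul_one]
    exact key a a.2
  · rw [mul_zero]
    by_contra hc
    exact hba (hA b a hc)

theorem Diagram.matrix_eq_corner {n r : ℕ} [NeZero r] (hr : 2 ≤ r) {c : Fin n}
    (T : Diagram n [down c] [down c]) (α : Fin n → ℂ) (hα : α c ∉ integers) :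
    T.matrix r α = T.corner r α • 1 := by
  have h := T.isHom_endo hr α
  have h1 : T.endo r α = T.corner r α • 1 := by
    refine eq_smul_one_of_commute (opE_coeff_ne_zero hr hα) (fun b a hba => ?_) h.mul_E
    have h2 : weight (α c) b = weight (α c) a + 0 := h.homogeneous b a hba
    simp only [weight] at h2
    have h3 : ((b : ℕ) : ℂ) = (a : ℕ) := by linear_combination -h2 / 2
    exact Fin.ext (Nat.cast_injective h3)
  ext ⟨b, ⟨⟩⟩ ⟨a, ⟨⟩⟩
  refine (congrFun (congrFun h1 b) a).trans ?_
  change _ * (1 : Matrix _ _ ℂ) b a = _ * (1 : Matrix (Fin r × Unit) (Fin r × Unit) ℂ) (b, ()) (a, ())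
  simp [Matrix.one_apply]

theorem Diagram.bracket_eq_corner {n r : ℕ} [NeZero r] (hr : 2 ≤ r) {c : Fin n}
    (T : Diagram n [down c] [down c]) (α : Fin n → ℂ) (hα : α c ∉ integers) :
    T.bracket r α = T.corner r α := by
  have h : ∃ z : ℂ, T.matrix r α = z • 1 := ⟨_, T.matrix_eq_corner hr α hα⟩
  have h1 := (T.matrix_eq_corner hr α hα).symm.trans h.choose_spec
  have h2 : T.corner r α * (1 : Matrix (Fin r × Unit) (Fin r × Unit) ℂ) (0, ()) (0, ()) =
      h.choose * (1 : Matrix (Fin r × Unit) (Fin r × Unit) ℂ) (0, ()) (0, ()) :=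
    congrFun (congrFun h1 _) _
  rw [Matrix.one_apply_eq, mul_one, mul_one] at h2
  rw [bracket, dif_pos h, h2]

/-- The only entry of $E^{r-1}$ that could be nonzero takes $v_{r-1}$ to $v_0$. It is the product of
all the coefficients of $E$, and the one at $v_{j+1}$ is the quantum integer $[\alpha-j]=[rk]=0$. -/
theorem opE_pow_pred_eq_zero {r : ℕ} (hr : r ≠ 0) {α : ℂ} {j : ℕ} (hj : j < r - 1) {k : ℤ}
    (hα : α = j + r * k) : opE r α ^ (r - 1) = 0 := by
  ext b a
  rw [opE_eq_shiftDown, shiftDown_pow_apply, Matrix.zero_apply]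
  split_ifs with h
  · refine Finset.prod_eq_zero (Finset.mem_range.2 hj) ?_
    rw [div_eq_zero_iff]
    left
    rw [zeta_sub_zeta_neg_eq_zero_iff hr]
    refine ⟨k, ?_⟩
    rw [hα, show (b : ℕ) = 0 by omega]
    push_cast
    ring
  · rfl

/-- The scalar of a (1,1)-tangle vanishes when `E ^ (r - 1)` is zero on the module of the open
component, if the colour of some other component is not an integer. -/
theorem Diagram.corner_eq_zero {n r : ℕ} [NeZero r] (hr : 2 ≤ r) {c : Fin n}
    (T : Diagram n [down c] [down c]) (hT : T.NumbersComponents) {α : Fin n → ℂ} {i : Fin n}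
    (hi : α i ∉ integers) {j : ℕ} (hj : j < r - 1) {k : ℤ} (hα : α c = j + r * k) :
    T.corner r α = 0 := by
  obtain ⟨⟨p, q⟩, hx⟩ := hT.1 i
  obtain ⟨x, hx', rfl⟩ := Option.map_eq_some_iff.1 hx
  obtain ⟨l, hl, hxl⟩ := Option.bind_eq_some_iff.1 hx'
  -- The diagram is cut along a horizontal line $l$ that meets the component $i$.
  obtain ⟨A, B, hA, hB, h⟩ := T.exists_matrix_eq_mul hr α (List.mem_of_getElem? hl)
  have hM := contractible_lineModule hr α (List.mem_of_getElem? hxl) hi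
  have hA' := hA.submatrix (Equiv.refl _) (Equiv.prodPUnit (Fin r)).symm rfl (verma_wt_eq α c) rfl
    (verma_E_eq α c)
  have hB' := hB.submatrix (Equiv.prodPUnit (Fin r)).symm (Equiv.refl _) (verma_wt_eq α c) rfl
    (verma_E_eq α c) rfl
  have h0 := hM.mulVec_eq_zero hA' hB' (opE_pow_pred_eq_zero (NeZero.ne r) hj hα)
    (x := Pi.single 0 1) (by
      ext b
      rw [Matrix.mulVec_single_one]
      change opE r (α c) b 0 = 0
      simp [opE])
  rw [Matrix.mulVec_single_one, Matrix.submatrix_mul_equiv, ← h] at h0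
  exact congrFun h0 0

/-! ### Smoothness -/

/-- A matrix depending smoothly on parameters. -/
def MatrixSmooth {X S T : Type} [NormedAddCommGroup X] [NormedSpace ℂ X]
    (A : X → Matrix S T ℂ) : Prop :=
  ∀ b a, ContDiff ℂ 2 fun x => A x b a

namespace MatrixSmooth

variable {X S T U V : Type} [NormedAddCommGroup X] [NormedSpace ℂ X]

theorem const (A : Matrix S T ℂ) : MatrixSmooth fun _ : X => A := fun _ _ => contDiff_const

theorem mul [Fintype T] {A : X → Matrix S T ℂ} {B : X → Matrix T U ℂ} (hA : MatrixSmooth A)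
    (hB : MatrixSmooth B) : MatrixSmooth fun x => A x * B x := fun b a => by
  simp only [Matrix.mul_apply]
  exact ContDiff.sum fun c _ => (hA b c).mul (hB c a)

theorem sum {ι : Type} (s : Finset ι) {A : ι → X → Matrix S T ℂ} (hA : ∀ i, MatrixSmooth (A i)) :
    MatrixSmooth fun x => ∑ i ∈ s, A i x := fun b a => by
  simp only [Matrix.sum_apply]
  exact ContDiff.sum fun c _ => hA c b a

theorem smul {A : X → Matrix S T ℂ} (hA : MatrixSmooth A) (z : ℂ) :
    MatrixSmooth fun x => z • A x := fun b a => contDiff_const.mul (hA b a)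

theorem kronecker {A : X → Matrix S T ℂ} {B : X → Matrix U V ℂ} (hA : MatrixSmooth A)
    (hB : MatrixSmooth B) : MatrixSmooth fun x => A x ⊗ₖ B x :=
  fun b a => (hA b.1 a.1).mul (hB b.2 a.2)

theorem pow [Fintype S] [DecidableEq S] {A : X → Matrix S S ℂ} (hA : MatrixSmooth A) (k : ℕ) :
    MatrixSmooth fun x => A x ^ k := by
  induction k with
  | zero => exact const 1
  | succ k ih =>
    simp only [pow_succ]
    exact ih.mul hA

end MatrixSmooth

theorem contDiff_zeta {X : Type} [NormedAddCommGroup X] [NormedSpace ℂ X] (r : ℕ) {f : X → ℂ}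
    (hf : ContDiff ℂ 2 f) : ContDiff ℂ 2 fun x => zeta r (f x) :=
  (contDiff_const.mul hf).cexp

section

variable {X : Type} [NormedAddCommGroup X] [NormedSpace ℂ X] (r : ℕ) {f g : X → ℂ}

theorem matrixSmooth_opE (hf : ContDiff ℂ 2 f) : MatrixSmooth fun x => opE r (f x) := by
  intro b a
  simp only [opE, Matrix.of_apply]
  split_ifs
  · have h1 : ContDiff ℂ 2 fun x => f x - ((a : ℕ) : ℂ) + 1 :=
      (hf.sub contDiff_const).add contDiff_const
    exact ((contDiff_zeta r h1).sub (contDiff_zeta r h1.neg)).div_const _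
  · exact contDiff_const

theorem matrixSmooth_opHH (s : ℂ) (hf : ContDiff ℂ 2 f) (hg : ContDiff ℂ 2 g) :
    MatrixSmooth fun x => opHH r s (f x) (g x) := by
  intro b a
  simp only [opHH, Matrix.diagonal_apply]
  split_ifs
  · exact contDiff_zeta r (contDiff_const.mul (((hf.sub contDiff_const).mul
      (hg.sub contDiff_const)).div_const _))
  · exact contDiff_const

theorem matrixSmooth_theta (c : ℕ → ℂ) (hf : ContDiff ℂ 2 f) :
    MatrixSmooth fun x => theta r c (f x) :=
  MatrixSmooth.sum _ fun k => (((matrixSmooth_opE r hf).pow k).kronecker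
    (MatrixSmooth.const (opF r ^ k))).smul (c k)

theorem matrixSmooth_braiding (hf : ContDiff ℂ 2 f) (hg : ContDiff ℂ 2 g) :
    MatrixSmooth fun x => braiding r (f x) (g x) := fun _ _ =>
  ((matrixSmooth_opHH r 1 hf hg).mul (matrixSmooth_theta r (rCoeff r) hf)) _ _

theorem matrixSmooth_braidingInv (hf : ContDiff ℂ 2 f) (hg : ContDiff ℂ 2 g) :
    MatrixSmooth fun x => braidingInv r (f x) (g x) := fun _ _ =>
  ((matrixSmooth_theta r (rInvCoeff r) hg).mul (matrixSmooth_opHH r (-1) hg hf)) _ _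

theorem contDiff_eigK (s : ℂ) (a : Fin r) (hf : ContDiff ℂ 2 f) :
    ContDiff ℂ 2 fun x => eigK r (f x) s a :=
  contDiff_zeta r (contDiff_const.mul (hf.sub contDiff_const))

end

theorem Layer.matrixSmooth {n r : ℕ} {v w : List (Strand n)} (s : Layer n v w) :
    MatrixSmooth fun α => s.matrix r α := by
  have hα (i : Fin n) : ContDiff ℂ 2 fun α : Fin n → ℂ => α i := contDiff_apply ℂ ℂ i
  induction s with
  | pos i j w =>
    rintro ⟨b', a', t⟩ ⟨a, b, s⟩
    change ContDiff ℂ 2 fun α : Fin n → ℂ =>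
      if t = s then braiding r (α i) (α j) (b', a') (a, b) else 0
    split_ifs
    exacts [matrixSmooth_braiding r (hα i) (hα j) _ _, contDiff_const]
  | neg i j w =>
    rintro ⟨b', a', t⟩ ⟨a, b, s⟩
    change ContDiff ℂ 2 fun α : Fin n → ℂ =>
      if t = s then braidingInv r (α i) (α j) (b', a') (a, b) else 0
    split_ifs
    exacts [matrixSmooth_braidingInv r (hα i) (hα j) _ _, contDiff_const]
  | cupR i w => exact MatrixSmooth.const _
  | capR i w => exact MatrixSmooth.const _
  | cupL i w =>
    rintro ⟨a, b, t⟩ s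
    change ContDiff ℂ 2 fun α : Fin n → ℂ => if t = s ∧ a = b then eigK r (α i) (r - 1) b else 0
    split_ifs
    exacts [contDiff_eigK r _ _ (hα i), contDiff_const]
  | capL i w =>
    rintro t ⟨a, b, s⟩
    change ContDiff ℂ 2 fun α : Fin n → ℂ => if t = s ∧ a = b then eigK r (α i) (1 - r) a else 0
    split_ifs
    exacts [contDiff_eigK r _ _ (hα i), contDiff_const]
  | skip x s ih =>
    rintro ⟨a', t'⟩ ⟨a, t⟩
    change ContDiff ℂ 2 fun α : Fin n → ℂ => if a' = a then s.matrix r α t' t else 0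
    split_ifs
    exacts [ih _ _, contDiff_const]

theorem Diagram.matrixSmooth {n r : ℕ} {v w : List (Strand n)} (D : Diagram n v w) :
    MatrixSmooth fun α => D.matrix r α := by
  induction D with
  | nil v => exact MatrixSmooth.const _
  | cons s D ih => exact ih.mul s.matrixSmooth

theorem Diagram.contDiff_corner {n r : ℕ} [NeZero r] {c : Fin n}
    (T : Diagram n [down c] [down c]) : ContDiff ℂ 2 (T.corner r) :=
  T.matrixSmooth _ _

/-! ### Quasi-periodicity -/

theorem opE_add_period {r : ℕ} (hr : r ≠ 0) (α : ℂ) : opE r (α + 2 * r) = opE r α := by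
  ext b a
  have h1 : zeta r (α + 2 * r - (a : ℕ) + 1) = zeta r (α - (a : ℕ) + 1) := by
    rw [← zeta_add_period hr (α - (a : ℕ) + 1) 1]
    push_cast
    ring_nf
  have h2 : zeta r (-(α + 2 * r - (a : ℕ) + 1)) = zeta r (-(α - (a : ℕ) + 1)) := by
    rw [zeta_neg, zeta_neg, h1]
  simp only [opE, Matrix.of_apply, h1, h2]

theorem theta_add_period {r : ℕ} (hr : r ≠ 0) (c : ℕ → ℂ) (α : ℂ) :
    theta r c (α + 2 * r) = theta r c α := by
  simp only [theta, opE_add_period hr]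

/-- In the exponent, the cross terms with the basis indices and the product of the two shifts are
multiples of $2r$ by integers. Only $r(x\beta+y\alpha)$ survives, so the change is a scalar. -/
theorem opHH_add_period {r : ℕ} (hr : r ≠ 0) (s : ℤ) (x y : ℤ) (α β : ℂ) :
    opHH r s (α + 2 * r * x) (β + 2 * r * y) =
      zeta r (s * (r * (x * β + y * α))) • opHH r s α β := by
  ext a b
  simp only [opHH, Matrix.diagonal_apply, Matrix.smul_apply, smul_eq_mul]
  split_ifs
  · rw [← zeta_add, ← zeta_add_period hr _
      (-(s * (r * (x * y) - x * (a.2 : ℕ) - y * (a.1 : ℕ))))]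
    congr 1
    simp only [weight]
    push_cast
    ring
  · rw [mul_zero]

theorem eigK_add_period {r : ℕ} (hr : r ≠ 0) (s : ℤ) (α : ℂ) (a : Fin r) :
    eigK r (α + 2 * r) s a = eigK r α s a := by
  rw [eigK, eigK, ← zeta_add_period hr (s * weight α a) s]
  congr 1
  simp only [weight]
  ring

theorem update_add_period {n : ℕ} (r : ℕ) (α : Fin n → ℂ) (i j : Fin n) :
    Function.update α i (α i + 2 * r) j = α j + 2 * r * ((if i = j then 1 else 0 : ℤ) : ℂ) := by
  by_cases h : i = j
  · subst h
    simp
  · rw [Function.update_of_ne (Ne.symm h), if_neg h]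
    simp

theorem theta_add_mul_period {r : ℕ} (hr : r ≠ 0) (c : ℕ → ℂ) (α : ℂ) (P : Prop) [Decidable P] :
    theta r c (α + 2 * r * ((if P then 1 else 0 : ℤ) : ℂ)) = theta r c α := by
  split_ifs
  · rw [Int.cast_one, mul_one, theta_add_period hr]
  · rw [Int.cast_zero, mul_zero, add_zero]

theorem eigK_add_mul_period {r : ℕ} (hr : r ≠ 0) (s : ℤ) (α : ℂ) (a : Fin r) (P : Prop)
    [Decidable P] :
    eigK r (α + 2 * r * ((if P then 1 else 0 : ℤ) : ℂ)) s a = eigK r α s a := by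
  split_ifs
  · rw [Int.cast_one, mul_one, eigK_add_period hr]
  · rw [Int.cast_zero, mul_zero, add_zero]

theorem braiding_add_period {n r : ℕ} (hr : r ≠ 0) (α : Fin n → ℂ) (i a b : Fin n) :
    braiding r (Function.update α i (α i + 2 * r) a) (Function.update α i (α i + 2 * r) b) =
      zeta r (r * ((if i = a then α b else 0) + (if i = b then α a else 0))) •
        braiding r (α a) (α b) := by
  have h := opHH_add_period hr 1 (if i = a then 1 else 0) (if i = b then 1 else 0) (α a) (α b)
  rw [Int.cast_one, one_mul] at h
  rw [update_add_period, update_add_period]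
  change (opHH r 1 _ _ * theta r (rCoeff r) _).submatrix _ _ =
    _ • (opHH r 1 _ _ * theta r (rCoeff r) _).submatrix _ _
  rw [theta_add_mul_period hr, h, Matrix.smul_mul]
  push_cast
  simp only [ite_mul, one_mul, zero_mul]
  rfl

theorem braidingInv_add_period {n r : ℕ} (hr : r ≠ 0) (α : Fin n → ℂ) (i a b : Fin n) :
    braidingInv r (Function.update α i (α i + 2 * r) a) (Function.update α i (α i + 2 * r) b) =
      zeta r (-(r * ((if i = a then α b else 0) + (if i = b then α a else 0)))) •
        braidingInv r (α a) (α b) := by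
  have h := opHH_add_period hr (-1) (if i = b then 1 else 0) (if i = a then 1 else 0) (α b) (α a)
  rw [Int.cast_neg, Int.cast_one] at h
  rw [update_add_period, update_add_period]
  change (theta r (rInvCoeff r) _ * opHH r (-1) _ _).submatrix _ _ =
    _ • (theta r (rInvCoeff r) _ * opHH r (-1) _ _).submatrix _ _
  rw [theta_add_mul_period hr, h, Matrix.mul_smul]
  push_cast
  simp only [ite_mul, one_mul, zero_mul, neg_mul, add_comm (if i = b then α a else 0)]
  rfl

/-- $E$, $F$ and the integral powers of $K$ at cups and caps are unchanged. Only $\zeta_{2r}^{\pm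
H\otimes H/2}$ at a crossing notices the shift, and its sign is the sign of the crossing. -/
theorem Layer.matrix_add_period {n r : ℕ} (hr : r ≠ 0) (α : Fin n → ℂ) (i : Fin n)
    {v w : List (Strand n)} (s : Layer n v w) :
    s.matrix r (Function.update α i (α i + 2 * r)) =
      zeta r (r * ∑ j, (s.over i j + s.over j i : ℤ) * α j) • s.matrix r α := by
  induction s with
  | pos a b w =>
    ext ⟨b', a', t⟩ ⟨x, y, s⟩
    change (if t = s then braiding r _ _ (b', a') (x, y) else 0) =
      _ * (if t = s then braiding r _ _ (b', a') (x, y) else 0)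
    rw [braiding_add_period hr, Matrix.smul_apply, smul_eq_mul, mul_ite, mul_zero]
    congr 4
    simp only [Layer.over]
    push_cast
    simp only [add_mul, Finset.sum_add_distrib, ite_mul, one_mul, zero_mul, ite_and]
    simp
  | neg a b w =>
    ext ⟨b', a', t⟩ ⟨x, y, s⟩
    change (if t = s then braidingInv r _ _ (b', a') (x, y) else 0) =
      _ * (if t = s then braidingInv r _ _ (b', a') (x, y) else 0)
    rw [braidingInv_add_period hr, Matrix.smul_apply, smul_eq_mul, mul_ite, mul_zero]
    congr 3
    rw [← mul_neg]
    congr 1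
    simp only [Layer.over]
    push_cast
    simp only [add_mul, Finset.sum_add_distrib, ite_mul, neg_mul, one_mul, zero_mul, ite_and]
    simp [add_comm]
    split_ifs <;> simp
  | cupR a w => simp [Layer.over, zeta_zero, Layer.matrix]
  | capR a w => simp [Layer.over, zeta_zero, Layer.matrix]
  | cupL a w =>
    ext ⟨x, y, t⟩ s
    have h := eigK_add_mul_period hr (r - 1) (α a) y (i = a)
    push_cast at h
    have h' := update_add_period r α i a
    push_cast at h'
    change (if t = s ∧ x = y then eigK r _ _ y else 0) =
      _ * (if t = s ∧ x = y then eigK r _ _ y else 0)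
    rw [h', h]
    simp [Layer.over, zeta_zero]
  | capL a w =>
    ext t ⟨x, y, s⟩
    have h := eigK_add_mul_period hr (1 - r) (α a) x (i = a)
    push_cast at h
    have h' := update_add_period r α i a
    push_cast at h'
    change (if t = s ∧ x = y then eigK r _ _ x else 0) =
      _ * (if t = s ∧ x = y then eigK r _ _ x else 0)
    rw [h', h]
    simp [Layer.over, zeta_zero]
  | skip x s ih =>
    ext ⟨a', t'⟩ ⟨a, t⟩
    change (if a' = a then s.matrix r _ t' t else 0) = _ * (if a' = a then s.matrix r _ t' t else 0)
    rw [ih, Matrix.smul_apply, smul_eq_mul, mul_ite, mul_zero]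
    rfl

theorem Diagram.matrix_add_period {n r : ℕ} (hr : r ≠ 0) (α : Fin n → ℂ) (i : Fin n)
    {v w : List (Strand n)} (D : Diagram n v w) :
    D.matrix r (Function.update α i (α i + 2 * r)) =
      zeta r (r * ∑ j, (D.linking i j + D.linking j i : ℤ) * α j) • D.matrix r α := by
  induction D with
  | nil v => simp [Diagram.matrix, Diagram.linking, zeta_zero]
  | cons s D ih =>
    rw [Diagram.matrix, Diagram.matrix, ih, s.matrix_add_period hr, Matrix.smul_mul,
      Matrix.mul_smul, smul_smul, ← zeta_add, ← mul_add, ← Finset.sum_add_distrib]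
    congr 4
    funext j
    simp only [Diagram.linking, Matrix.add_apply, Matrix.of_apply]
    push_cast
    ring

/-- Symmetry of the linking matrix merges the two kinds of crossings, $i$ over $j$ and $j$ over $i$,
into the factor $2$. -/
theorem Diagram.corner_add_period {n r : ℕ} [NeZero r] {c : Fin n}
    (T : Diagram n [down c] [down c]) (α : Fin n → ℂ) (i : Fin n) :
    T.corner r (Function.update α i (α i + 2 * r)) =
      zeta r (2 * r * ∑ j, T.linking i j * α j) * T.corner r α := by
  have h := T.matrix_add_period (NeZero.ne r) α i
  have h1 : (r : ℂ) * ∑ j, (T.linking i j + T.linking j i : ℤ) * α j =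
      2 * r * ∑ j, T.linking i j * α j := by
    rw [mul_comm (2 : ℂ), mul_assoc, Finset.mul_sum _ _ (2 : ℂ)]
    congr 2
    funext j
    rw [T.linking_comm j i]
    push_cast
    ring
  rw [h1] at h
  exact congrFun (congrFun h _) _

/-! ### Division by a coordinate -/

/-- Differentiation under the integral: the dominating constant is a bound for $G'$ on a closed unit
ball times $[0,1]$, which is compact. -/
theorem differentiable_intervalIntegral {E : Type} [NormedAddCommGroup E] [NormedSpace ℂ E]
    [ProperSpace E] {G : E → ℝ → ℂ} {G' : E → ℝ → E →L[ℂ] ℂ}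
    (hG' : Continuous (Function.uncurry G')) (hG : Continuous (Function.uncurry G))
    (h : ∀ x t, HasFDerivAt (fun y => G y t) (G' x t) x) :
    Differentiable ℂ fun x => ∫ t in (0 : ℝ)..1, G x t := by
  intro x₀
  obtain ⟨C, hC⟩ := ((isCompact_closedBall x₀ 1).prod (isCompact_Icc (a := (0 : ℝ))
    (b := 1))).exists_bound_of_continuousOn hG'.continuousOn
  refine (intervalIntegral.hasFDerivAt_integral_of_dominated_of_fderiv_le (F' := G')
    (bound := fun _ => C) (Metric.closedBall_mem_nhds x₀ one_pos) ?_ ?_ ?_ ?_ ?_ ?_).differentiableAt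
  · exact Filter.Eventually.of_forall fun x =>
      (hG.comp (Continuous.prodMk_right x)).aestronglyMeasurable
  · exact (hG.comp (Continuous.prodMk_right x₀)).intervalIntegrable _ _
  · exact (hG'.comp (Continuous.prodMk_right x₀)).aestronglyMeasurable
  · refine Filter.Eventually.of_forall fun t ht x hx => hC (x, t) ⟨hx, ?_⟩
    rw [Set.uIoc_of_le zero_le_one] at ht
    exact Set.Ioc_subset_Icc_self ht
  · exact intervalIntegrable_const
  · exact Filter.Eventually.of_forall fun t _ x _ => h x t

/-- A function which vanishes on a coordinate hyperplane is divisible by the equation of the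
hyperplane. -/
theorem exists_eq_mul_of_eq_zero {n : ℕ} {φ : (Fin n → ℂ) → ℂ} (hφ : ContDiff ℂ 2 φ) (c : Fin n)
    (m : ℂ) (h : ∀ α, α c = m → φ α = 0) :
    ∃ ψ : (Fin n → ℂ) → ℂ, Differentiable ℂ ψ ∧ ∀ α, φ α = (α c - m) * ψ α := by
  set e : Fin n → ℂ := Pi.single c 1
  set θ : (Fin n → ℂ) → ℂ := fun α => fderiv ℂ φ α e
  have hθ : ContDiff ℂ 1 θ :=
    (hφ.fderiv_right (m := 1) (by norm_num)).clm_apply contDiff_const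
  -- Hadamard's lemma. The point $l(\alpha,t)$ has $c$-th coordinate $m+t(\alpha_c-m)$, so it runs
  -- from the hyperplane to $\alpha$, and the quotient is the integral of $\partial_c\varphi$ along
  -- this segment. Two derivatives of $\varphi$ are needed so that $\partial_c\varphi$ is
  -- continuously differentiable under the integral.
  let l : (Fin n → ℂ) → ℝ → (Fin n → ℂ) := fun α t => α - ((1 - (t : ℂ)) * (α c - m)) • e
  let l' : ℝ → (Fin n → ℂ) →L[ℂ] (Fin n → ℂ) := fun t =>
    ContinuousLinearMap.id ℂ _ - (1 - (t : ℂ)) • (ContinuousLinearMap.proj c).smulRight e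
  have hl : Continuous (Function.uncurry l) := by
    simp only [l, Function.uncurry_def]
    fun_prop
  have hl' : Continuous l' := by
    simp only [l']
    fun_prop
  have hd : ∀ α t, HasFDerivAt (fun α => l α t) (l' t) α := by
    intro α t
    have h1 : HasFDerivAt (fun α : Fin n → ℂ => α c) (ContinuousLinearMap.proj c) α :=
      (ContinuousLinearMap.proj (R := ℂ) (φ := fun _ : Fin n => ℂ) c).hasFDerivAt
    have h2 := (hasFDerivAt_id α).sub (((h1.sub_const m).const_mul (1 - (t : ℂ))).smul_const e)
    refine h2.congr_fderiv ?_
    ext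
    simp [l']
    ring
  refine ⟨fun α => ∫ t in (0 : ℝ)..1, θ (l α t), ?_, fun α => ?_⟩
  · refine differentiable_intervalIntegral
      (G' := fun α t => (fderiv ℂ θ (l α t)).comp (l' t)) ?_ ?_ fun α t => ?_
    · exact ((hθ.continuous_fderiv one_ne_zero).comp hl).clm_comp (hl'.comp continuous_snd)
    · exact hθ.continuous.comp hl
    · exact ((hθ.differentiable one_ne_zero) _).hasFDerivAt.comp α (hd α t)
  · have h1 : ∀ t ∈ Set.uIcc (0 : ℝ) 1,
        HasDerivAt (fun t : ℝ => φ (l α t)) ((α c - m) * θ (l α t)) t := by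
      intro t _
      have h2 : HasDerivAt (fun t : ℂ => α - ((1 - t) * (α c - m)) • e) ((α c - m) • e) (t : ℂ) := by
        have h3 := ((((hasDerivAt_id (t : ℂ)).const_sub 1).mul_const (α c - m)).smul_const
          e).const_sub α
        refine h3.congr_deriv ?_
        rw [neg_one_mul, neg_smul, neg_neg]
      have h4 := (((hφ.differentiable two_ne_zero) (l α t)).hasFDerivAt.comp_hasDerivAt (t : ℂ)
        h2).comp_ofReal
      refine h4.congr_deriv ?_
      rw [map_smul, smul_eq_mul]
    have h2 := intervalIntegral.integral_eq_sub_of_hasDerivAt h1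
      (((continuous_const.mul (hθ.continuous.comp (hl.comp
        (Continuous.prodMk_right α))))).intervalIntegrable _ _)
    rw [intervalIntegral.integral_const_mul] at h2
    rw [h2]
    have h3 : φ (l α 0) = 0 := h _ (by simp [l, e])
    have h4 : l α 1 = α := by simp [l]
    rw [h3, h4, sub_zero]

/-- A function which vanishes on the zeros of a function of one coordinate with simple zeros is
divisible by this function. -/
theorem exists_eq_mul_of_simple_zeros {n : ℕ} {φ : (Fin n → ℂ) → ℂ} (hφ : ContDiff ℂ 2 φ)
    (c : Fin n) {D : ℂ → ℂ} (hD : Differentiable ℂ D) (hD' : ∀ z, D z = 0 → deriv D z ≠ 0)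
    (h : ∀ α, D (α c) = 0 → φ α = 0) :
    ∃ f : (Fin n → ℂ) → ℂ, Differentiable ℂ f ∧ ∀ α, φ α = D (α c) * f α := by
  classical
  have hp : ∀ α : Fin n → ℂ, HasFDerivAt (fun α : Fin n → ℂ => α c)
      (ContinuousLinearMap.proj c : (Fin n → ℂ) →L[ℂ] ℂ) α := fun α =>
    (ContinuousLinearMap.proj (R := ℂ) (φ := fun _ : Fin n => ℂ) c).hasFDerivAt
  -- The value on the zeros of $D$ is the one given by l'Hôpital's rule. Near a zero $m$ of $D$ the
  -- quotient agrees with $\psi$ over `dslope D m`, whose value at $m$ is $D'(m)\ne0$.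
  refine ⟨fun α => if D (α c) = 0 then fderiv ℂ φ α (Pi.single c 1) / deriv D (α c) else
    φ α / D (α c), fun α₀ => ?_, fun α => ?_⟩
  · have hc : ContinuousAt (fun α : Fin n → ℂ => α c) α₀ := (continuous_apply c).continuousAt
    by_cases h0 : D (α₀ c) = 0
    · obtain ⟨ψ, hψ, hψ'⟩ := exists_eq_mul_of_eq_zero hφ c (α₀ c)
        fun α hα => h α (by rw [hα, h0])
      set m := α₀ c with hm
      have hD₁ : Differentiable ℂ (dslope D m) := by
        rw [← differentiableOn_univ, Complex.differentiableOn_dslope Filter.univ_mem]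
        exact hD.differentiableOn
      have hDm : ∀ z, D z = (z - m) * dslope D m z := fun z => by
        have := sub_smul_dslope D m z
        rw [h0, sub_zero, smul_eq_mul] at this
        exact this.symm
      have hne : dslope D m m ≠ 0 := by
        rw [dslope_same]
        exact hD' m h0
      have hq : DifferentiableAt ℂ (fun α : Fin n → ℂ => dslope D m (α c)) α₀ :=
        (hD₁ m).comp α₀ (hp α₀).differentiableAt
      have hd : DifferentiableAt ℂ (fun α : Fin n → ℂ => ψ α / dslope D m (α c)) α₀ := by
        simp only [div_eq_mul_inv]
        exact (hψ α₀).fun_mul (hq.fun_inv hne)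
      refine hd.congr_of_eventuallyEq ?_
      filter_upwards [hc.eventually ((hD₁.continuous.continuousAt (x := m)).eventually_ne hne)]
        with α hα
      by_cases hαm : α c = m
      · have hf : fderiv ℂ φ α (Pi.single c 1) = ψ α := by
          have h1 : HasFDerivAt φ _ α :=
            (((hp α).sub_const m).mul (hψ α).hasFDerivAt).congr_of_eventuallyEq
              (Filter.Eventually.of_forall hψ')
          rw [h1.fderiv]
          simp [hαm]
        rw [if_pos (by rw [hαm, h0]), hf, hαm, dslope_same]
      · have h1 := sub_ne_zero.2 hαm
        rw [if_neg (by rw [hDm]; exact mul_ne_zero h1 hα), hψ', hDm, mul_div_mul_left _ _ h1]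
    · have hq : DifferentiableAt ℂ (fun α : Fin n → ℂ => D (α c)) α₀ :=
        (hD _).comp α₀ (hp α₀).differentiableAt
      have hd : DifferentiableAt ℂ (fun α : Fin n → ℂ => φ α / D (α c)) α₀ := by
        simp only [div_eq_mul_inv]
        exact ((hφ.differentiable two_ne_zero) α₀).fun_mul (hq.fun_inv h0)
      refine hd.congr_of_eventuallyEq ?_
      filter_upwards [hc.eventually ((hD.continuous.continuousAt (x := α₀ c)).eventually_ne h0)]
        with α hα
      rw [if_neg hα]
  · simp only
    split_ifs with h0
    · rw [h0, zero_mul, h α h0]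
    · rw [mul_div_cancel₀ _ h0]

theorem dense_compl_integers : Dense integersᶜ :=
  (Set.countable_range _).dense_compl ℂ

/-- A continuous function vanishes if it vanishes where one coordinate is not an integer. -/
theorem eq_zero_of_continuous {n : ℕ} {φ : (Fin n → ℂ) → ℂ} (hφ : Continuous φ) (c : Fin n)
    (h : ∀ α, α c ∉ integers → φ α = 0) (α : Fin n → ℂ) : φ α = 0 := by
  have h1 : (fun z => φ (Function.update α c z)) = fun _ => 0 :=
    Continuous.ext_on dense_compl_integers
      (hφ.comp (continuous_const.update c continuous_id)) continuous_const fun z hz =>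
      h _ (by rwa [Function.update_self])
  simpa using congrFun h1 (α c)

/-! ### The modified dimension -/

/-- The inverse of the modified dimension. -/
def dimDen (r : ℕ) (z : ℂ) : ℂ :=
  ∏ j ∈ Finset.range (r - 1), (zeta r (z + r - j) - zeta r (-(z + r - j)))

theorem modifiedDim_eq (r : ℕ) (z : ℂ) : modifiedDim r z = (dimDen r z)⁻¹ := by
  simp only [modifiedDim, dimDen, one_div, Finset.prod_inv_distrib]

theorem dimDen_factor_eq_zero_iff {r : ℕ} (hr : r ≠ 0) (z : ℂ) (j : ℕ) :
    zeta r (z + r - j) - zeta r (-(z + r - j)) = 0 ↔ ∃ k : ℤ, z = j + r * k := by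
  rw [zeta_sub_zeta_neg_eq_zero_iff hr]
  constructor
  · rintro ⟨k, hk⟩
    refine ⟨k - 1, ?_⟩
    push_cast
    linear_combination hk
  · rintro ⟨k, hk⟩
    refine ⟨k + 1, ?_⟩
    push_cast
    linear_combination hk

theorem dimDen_eq_zero_iff {r : ℕ} (hr : r ≠ 0) (z : ℂ) :
    dimDen r z = 0 ↔ ∃ j < r - 1, ∃ k : ℤ, z = j + r * k := by
  simp only [dimDen, Finset.prod_eq_zero_iff, Finset.mem_range, dimDen_factor_eq_zero_iff hr]

theorem dimDen_ne_zero {r : ℕ} (hr : r ≠ 0) {z : ℂ} (hz : z ∉ integers) : dimDen r z ≠ 0 := by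
  rw [Ne, dimDen_eq_zero_iff hr]
  rintro ⟨j, -, k, rfl⟩
  exact hz ⟨j + r * k, by push_cast; ring⟩

theorem differentiable_zeta (r : ℕ) : Differentiable ℂ (zeta r) := by
  unfold zeta
  fun_prop

theorem hasDerivAt_zeta (r : ℕ) (z : ℂ) :
    HasDerivAt (zeta r) (Real.pi * Complex.I / r * zeta r z) z := by
  have h := ((hasDerivAt_id z).const_mul (Real.pi * Complex.I / r)).cexp
  refine h.congr_deriv ?_
  simp [zeta, mul_comm]

theorem differentiable_dimDen (r : ℕ) : Differentiable ℂ (dimDen r) := by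
  unfold dimDen zeta
  fun_prop

/-- Each factor has simple zeros, as $\zeta_{2r}^x=\zeta_{2r}^{-x}$ makes its derivative
$\tfrac{2\pi\sqrt{-1}}{r}\zeta_{2r}^x$. Two factors have no common zero, since their indices are
distinct modulo $r$. -/
theorem deriv_dimDen_ne_zero {r : ℕ} (hr : r ≠ 0) {z : ℂ} (hz : dimDen r z = 0) :
    deriv (dimDen r) z ≠ 0 := by
  obtain ⟨j, hj, k, hk⟩ := (dimDen_eq_zero_iff hr z).1 hz
  set d : ℕ → ℂ → ℂ := fun j z => zeta r (z + r - j) - zeta r (-(z + r - j)) with hd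
  have hz0 : d j z = 0 := (dimDen_factor_eq_zero_iff hr z j).2 ⟨k, hk⟩
  have h1 : HasDerivAt (d j) (Real.pi * Complex.I / r *
      (zeta r (z + r - j) + zeta r (-(z + r - j)))) z := by
    have h2 : HasDerivAt (fun z : ℂ => z + r - j) 1 z :=
      ((hasDerivAt_id z).add_const _).sub_const _
    have h3 := ((hasDerivAt_zeta r _).comp z h2).sub ((hasDerivAt_zeta r _).comp z h2.neg)
    refine h3.congr_deriv ?_
    rw [Pi.neg_apply]
    ring
  have h4 : dimDen r = fun z => d j z * ∏ i ∈ (Finset.range (r - 1)).erase j, d i z := by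
    funext z
    exact (Finset.mul_prod_erase _ (fun i => d i z) (Finset.mem_range.2 hj)).symm
  have h5 : DifferentiableAt ℂ (fun z => ∏ i ∈ (Finset.range (r - 1)).erase j, d i z) z := by
    simp only [hd, zeta]
    fun_prop
  rw [h4, (h1.fun_mul h5.hasDerivAt).deriv, hz0, zero_mul, add_zero]
  refine mul_ne_zero (mul_ne_zero ?_ ?_) (Finset.prod_ne_zero_iff.2 fun i hi h6 => ?_)
  · exact div_ne_zero (mul_ne_zero (Complex.ofReal_ne_zero.2 Real.pi_ne_zero) Complex.I_ne_zero)
      (Nat.cast_ne_zero.2 hr)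
  · rw [← sub_eq_zero.1 hz0, ← two_mul]
    exact mul_ne_zero two_ne_zero (zeta_ne_zero r _)
  · obtain ⟨k', hk'⟩ := (dimDen_factor_eq_zero_iff hr z i).1 h6
    obtain ⟨h7, h8⟩ := Finset.mem_erase.1 hi
    have h9 : (i : ℤ) - j = r * (k - k') := by
      have : ((i : ℂ) - j) = r * (k - k') := by linear_combination hk - hk'
      exact_mod_cast this
    have h10 := Finset.mem_range.1 h8
    have h11 : (i : ℤ) - j = 0 := by
      refine Int.eq_zero_of_abs_lt_dvd (m := (r : ℤ)) ⟨_, h9⟩ ?_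
      rw [abs_lt]
      omega
    omega

theorem dimDen_add_period {r : ℕ} (hr : r ≠ 0) (z : ℂ) : dimDen r (z + 2 * r) = dimDen r z := by
  refine Finset.prod_congr rfl fun j _ => ?_
  have h1 : zeta r (z + 2 * r + r - j) = zeta r (z + r - j) := by
    rw [← zeta_add_period hr (z + r - j) 1]
    push_cast
    ring_nf
  rw [zeta_neg, zeta_neg, h1]

/-! ### Sections of the line bundle -/

theorem cover_add_period {r n : ℕ} (α : Fin n → ℂ) (m : Fin n → ℤ) :
    cover r n α = cover r n fun i => α i + m i * (2 * r) := by
  funext i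
  refine QuotientAddGroup.eq.2 (AddSubgroup.mem_zmultiples_iff.2 ⟨m i, ?_⟩)
  rw [zsmul_eq_mul]
  ring

/-- A function on `ℂ^n` which changes by the factors of the line bundle under translations along
the coordinates changes by the factors of the line bundle between all points with the same image
in `(ℂ / 2rℤ)^n`. -/
theorem eq_factor_mul_of_cover_eq {r n : ℕ} {C : Matrix (Fin n) (Fin n) ℤ}
    {f : (Fin n → ℂ) → ℂ} (hf : ∀ α i, f (Function.update α i (α i + 2 * r)) =
      zeta r (2 * r * ∑ j, C i j * α j) * f α)
    {α β : Fin n → ℂ} (h : cover r n α = cover r n β) : f β = factor r C α β * f α := by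
  -- The translations under which $f$ transforms by `factor` form a group, by the cocycle identity
  -- `factor_mul`. It is therefore enough to treat the coordinate generators.
  let H : AddSubgroup (Fin n → ℤ) :=
    { carrier := {m | ∀ α : Fin n → ℂ, f (fun i => α i + m i * (2 * r)) =
        factor r C α (fun i => α i + m i * (2 * r)) * f α}
      zero_mem' := fun α => by simp [factor_self]
      add_mem' := fun {a b} ha hb α => by
        have h1 := hb fun i => α i + a i * (2 * r)
        rw [ha α, ← mul_assoc, factor_mul r C (cover_add_period α a) (cover_add_period _ b)] at h1
        have e : (fun i => α i + a i * (2 * (r : ℂ)) + b i * (2 * r)) =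
            fun i => α i + (a + b) i * (2 * (r : ℂ)) := by
          funext i
          simp only [Pi.add_apply, Int.cast_add]
          ring
        rwa [e] at h1
      neg_mem' := fun {a} ha α => by
        have h1 := ha fun i => α i + (-a) i * (2 * r)
        have e : (fun i => α i + (-a) i * (2 * (r : ℂ)) + a i * (2 * r)) = α := by
          funext i
          simp only [Pi.neg_apply, Int.cast_neg]
          ring
        have h2 := cover_add_period (r := r) α (-a)
        rw [e] at h1
        rw [h1, ← mul_assoc, factor_mul r C h2.symm h2, factor_self, one_mul] }
  have hH : ∀ m, m ∈ H := fun m => by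
    refine AddSubgroup.pi_mem_of_single_mem m fun i => ?_
    have h1 : Pi.single i 1 ∈ H := fun α => by
      have e : (fun j => α j + ((Pi.single i 1 : Fin n → ℤ) j) * (2 * (r : ℂ))) =
          Function.update α i (α i + 2 * r) := by
        funext j
        by_cases hj : j = i
        · subst hj
          simp
        · simp [hj]
      have e' : ∑ k, ∑ j, (Function.update α i (α i + 2 * r) k - α k) * C k j * α j =
          2 * r * ∑ j, C i j * α j := by
        rw [Finset.sum_eq_single i]
        · simp only [Function.update_self, add_sub_cancel_left, Finset.mul_sum, mul_assoc]
        · intro j _ hj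
          simp [hj]
        · simp
      rw [e, hf, factor, e']
    have h2 : Pi.single i (m i) = m i • (Pi.single i 1 : Fin n → ℤ) := by
      rw [← Pi.single_smul, smul_eq_mul, mul_one]
    rw [h2]
    exact H.zsmul_mem h1 _
  obtain ⟨m, hm⟩ := exists_int_of_cover_eq h
  have e : β = fun i => α i + m i * (2 * (r : ℂ)) := by
    funext i
    rw [← hm i]
    ring
  rw [e]
  exact hH m α

theorem cover_chart {r n : ℕ} (p : Fin n → ℂ) {x : Base r n} (hx : x ∈ (chart p).source) :
    cover r n (chart p x) = x :=
  (cover_isLocalHomeomorph r n).apply_localInverseAt_of_mem hx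

theorem cover_mem_source {r n : ℕ} (p : Fin n → ℂ) {α : Fin n → ℂ}
    (hα : α ∈ (chart (r := r) p).target) : cover r n α ∈ (chart p).source := by
  have h := (chart (r := r) p).map_target hα
  rwa [chart, (cover_isLocalHomeomorph r n).localInverseAt_symm] at h

theorem chart_cover {r n : ℕ} (p : Fin n → ℂ) {α : Fin n → ℂ}
    (hα : α ∈ (chart (r := r) p).target) : chart p (cover r n α) = α := by
  have h := (chart (r := r) p).right_inv hα
  rwa [chart, (cover_isLocalHomeomorph r n).localInverseAt_symm] at h

/-- A function on `ℂ^n` which changes by the factors of the line bundle under translations along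
the coordinates is a section of the line bundle. -/
theorem exists_section {r n : ℕ} {C : Matrix (Fin n) (Fin n) ℤ} {f : (Fin n → ℂ) → ℂ}
    (hf : ∀ α i, f (Function.update α i (α i + 2 * r)) =
      zeta r (2 * r * ∑ j, C i j * α j) * f α) :
    ∃ s : ∀ x, (lineBundle r C).Fiber x,
      ∀ p, ∀ α ∈ (chart (r := r) p).target, localCoord s p α = f α := by
  -- The fibre over $x$ is identified with $\mathbb C$ through the preferred chart at $x$, so the
  -- section has there the value of $f$ at the corresponding lift of $x$.
  let s : ∀ x, (lineBundle r C).Fiber x := fun x => f (chart ((lineBundle r C).indexAt x) x)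
  refine ⟨s, fun p α hα => ?_⟩
  set x := cover r n α with hx
  have h1 : cover r n (chart ((lineBundle r C).indexAt x) x) = x :=
    cover_chart _ ((lineBundle r C).mem_baseSet_at x)
  have h2 : cover r n (chart p x) = x := cover_chart p (cover_mem_source p hα)
  have h3 := eq_factor_mul_of_cover_eq hf (h1.trans h2.symm)
  rw [hx, chart_cover p hα, ← hx] at h3
  rw [h3]
  change factor r C _ (chart p x) * f _ = _
  rw [hx, chart_cover p hα]
  rfl

/-! ### The invariant -/

theorem Diagram.invariant_eq {n r : ℕ} [NeZero r] (hr : 2 ≤ r) {c : Fin n}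
    (T : Diagram n [down c] [down c]) (α : Fin n → ℂ) (hα : α c ∉ integers) :
    T.invariant r α = (dimDen r (α c))⁻¹ * T.corner r α := by
  rw [invariant, T.bracket_eq_corner hr α hα, modifiedDim_eq]

theorem dimDen_update {n r : ℕ} (hr : r ≠ 0) (α : Fin n → ℂ) (i c : Fin n) :
    dimDen r (Function.update α i (α i + 2 * r) c) = dimDen r (α c) := by
  by_cases h : c = i
  · subst h
    rw [Function.update_self, dimDen_add_period hr]
  · rw [Function.update_of_ne h]

/-- The scalar of a (1,1)-tangle of a link with several components vanishes at the poles of the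
modified dimension. -/
theorem Diagram.corner_eq_zero_of_dimDen_eq_zero {n r : ℕ} [NeZero r] (hr : 2 ≤ r) (hn : 1 < n)
    {c : Fin n} (T : Diagram n [down c] [down c]) (hT : T.NumbersComponents) (α : Fin n → ℂ)
    (hα : dimDen r (α c) = 0) : T.corner r α = 0 := by
  have : Nontrivial (Fin n) := Fin.nontrivial_iff_two_le.2 hn
  obtain ⟨i, hi⟩ := exists_ne c
  obtain ⟨j, hj, k, hk⟩ := (dimDen_eq_zero_iff (NeZero.ne r) _).1 hα
  -- The colour of $c$ is frozen at the zero of `dimDen`, and density is used in the colour of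
  -- another component $i$ only.
  have h := eq_zero_of_continuous (φ := fun β => T.corner r (Function.update β c (α c)))
    ((T.contDiff_corner (r := r)).continuous.comp (continuous_id.update c continuous_const)) i
    (fun β hβ => T.corner_eq_zero hr hT (i := i) (by rwa [Function.update_of_ne hi]) hj
      (by rw [Function.update_self, hk])) α
  simpa using h

/-- The invariant of a link with several components extends to a quasi-periodic holomorphic
function. -/
theorem Diagram.exists_extension {n r : ℕ} [NeZero r] (hr : 2 ≤ r) (hn : 1 < n)
    {c : Fin n} (T : Diagram n [down c] [down c]) (hT : T.NumbersComponents) :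
    ∃ f : (Fin n → ℂ) → ℂ, Differentiable ℂ f ∧
      (∀ α, α c ∉ integers → f α = T.invariant r α) ∧
      ∀ α i, f (Function.update α i (α i + 2 * r)) =
        zeta r (2 * r * ∑ j, T.linking i j * α j) * f α := by
  have hr0 := NeZero.ne r
  obtain ⟨f, hf, hf'⟩ := exists_eq_mul_of_simple_zeros (T.contDiff_corner (r := r)) c
    (differentiable_dimDen r) (fun z => deriv_dimDen_ne_zero hr0)
    (T.corner_eq_zero_of_dimDen_eq_zero hr hn hT)
  refine ⟨f, hf, fun α hα => ?_, fun α i => ?_⟩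
  · rw [T.invariant_eq hr α hα, hf', inv_mul_cancel_left₀ (dimDen_ne_zero hr0 hα)]
  -- Where $\alpha_c\notin\mathbb Z$, the nonzero `dimDen` cancels from the quasi-periodicity of the
  -- corner. Continuity gives the remaining points.
  · have hc : Continuous fun α : Fin n → ℂ => f (Function.update α i (α i + 2 * r)) -
        zeta r (2 * r * ∑ j, T.linking i j * α j) * f α := by
      refine (hf.continuous.comp (continuous_id.update i ((continuous_apply i).add
        continuous_const))).sub (((differentiable_zeta r).continuous.comp ?_).mul hf.continuous)
      fun_prop
    refine sub_eq_zero.1 (eq_zero_of_continuous hc c (fun α hα => ?_) α)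
    have h := T.corner_add_period (r := r) α i
    rw [hf', hf' α, dimDen_update hr0, mul_left_comm] at h
    exact sub_eq_zero.2 (mul_left_cancel₀ (dimDen_ne_zero hr0 hα) h)

/-- The scalar of a (1,1)-tangle is holomorphic in a common colour of all components. -/
theorem Diagram.differentiable_corner_diag {n r : ℕ} [NeZero r] {c : Fin n}
    (T : Diagram n [down c] [down c]) : Differentiable ℂ fun z : ℂ => T.corner r fun _ => z :=
  ((T.contDiff_corner (r := r)).differentiable two_ne_zero).comp (differentiable_pi.2 fun _ => differentiable_id)

/-- Orders add: $G$ has order at least $0$, and $D$ has order $0$ or $1$ at $z$. -/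
theorem neg_one_le_meromorphicOrderAt_div {G D : ℂ → ℂ} (hG : Differentiable ℂ G)
    (hD : Differentiable ℂ D) (z : ℂ) (hDz : D z = 0 → deriv D z ≠ 0) :
    -1 ≤ meromorphicOrderAt (fun z => (D z)⁻¹ * G z) z := by
  have hG' := hG.analyticAt z
  have hD' := hD.analyticAt z
  have h1 : -1 ≤ meromorphicOrderAt (fun z => (D z)⁻¹) z := by
    change _ ≤ meromorphicOrderAt D⁻¹ z
    rw [meromorphicOrderAt_inv, hD'.meromorphicOrderAt_eq]
    by_cases h : D z = 0
    · rw [hD'.analyticOrderAt_eq_one_of_zero_deriv_ne_zero h (hDz h)]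
      rfl
    · rw [hD'.analyticOrderAt_eq_zero.2 h]
      decide
  change _ ≤ meromorphicOrderAt (D⁻¹ * G) z
  rw [meromorphicOrderAt_mul hD'.meromorphicAt.inv hG'.meromorphicAt]
  have := add_le_add h1 hG'.meromorphicOrderAt_nonneg
  rwa [add_zero] at this

theorem add_period_notMem_integers {r : ℕ} {z : ℂ} (hz : z ∉ integers) :
    z + 2 * r ∉ integers := by
  rintro ⟨k, hk⟩
  refine hz ⟨k - 2 * r, ?_⟩
  push_cast
  rw [hk]
  ring

end ADO

end

/-! ### The main theorem -/

theorem mainTheorem6 (r : ℕ) (hr : 2 ≤ r) (n : ℕ) (c : Fin n)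
    (T : ADO.Diagram n [ADO.Strand.down c] [ADO.Strand.down c]) (hT : T.NumbersComponents) :
    -- the scalar `⟨T⟩` in the definition of the invariant exists
    (∀ α : Fin n → ℂ, (∀ i, α i ∉ ADO.integers) → T.matrix r α = T.bracket r α • 1) ∧
    -- knots
    (n = 1 → ∃ f : ℂ → ℂ,
      (∀ z, z ∉ ADO.integers → f z = T.invariant r fun _ => z) ∧
      Meromorphic f ∧
      (∀ z, z ∉ ADO.integers → AnalyticAt ℂ f z) ∧
      ∀ m : ℤ, -1 ≤ meromorphicOrderAt f (m : ℂ)) ∧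
    -- links with more than one component
    (1 < n → ∃ f : (Fin n → ℂ) → ℂ,
      (∀ α, (∀ i, α i ∉ ADO.integers) → f α = T.invariant r α) ∧
      Differentiable ℂ f) ∧
    -- quasi-periodicity
    (∀ α : Fin n → ℂ, (∀ i, α i ∉ ADO.integers) → ∀ i,
      T.invariant r (Function.update α i (α i + 2 * r)) =
        (∏ j, ADO.zeta r (2 * r * T.linking i j * α j)) * T.invariant r α) ∧
    -- the invariant is a section of a line bundle
    (∃ s : ∀ x, (ADO.lineBundle r T.linking).Fiber x,
      (∀ p, ∀ α ∈ (ADO.chart (r := r) p).target, (∀ i, α i ∉ ADO.integers) →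
        ADO.localCoord s p α = T.invariant r α) ∧
      (n = 1 → ∀ p, MeromorphicOn (fun z : ℂ => ADO.localCoord s p fun _ => z)
        {z : ℂ | (fun _ => z) ∈ (ADO.chart (r := r) p).target}) ∧
      (1 < n → ∀ p, DifferentiableOn ℂ (ADO.localCoord s p) (ADO.chart (r := r) p).target)) := by
  open ADO in
  have hr0 : r ≠ 0 := by omega
  have : NeZero r := ⟨hr0⟩
  have hG := T.differentiable_corner_diag (r := r)
  have hD := differentiable_dimDen r
  have hmer : Meromorphic fun z : ℂ => (dimDen r z)⁻¹ * T.corner r fun _ => z := fun z =>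
    (hD.analyticAt z).meromorphicAt.inv.mul (hG.analyticAt z).meromorphicAt
  refine ⟨fun α hα => ?_, fun _ => ?_, fun hn => ?_, fun α hα i => ?_, ?_⟩
  · rw [T.bracket_eq_corner hr α (hα c)]
    exact T.matrix_eq_corner hr α (hα c)
  · refine ⟨fun z => (dimDen r z)⁻¹ * T.corner r fun _ => z, fun z hz => ?_, hmer, fun z hz => ?_,
      fun m => ?_⟩
    · exact (T.invariant_eq hr (fun _ => z) hz).symm
    · exact ((hD.analyticAt z).inv (dimDen_ne_zero hr0 hz)).mul (hG.analyticAt z)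
    · exact neg_one_le_meromorphicOrderAt_div hG hD _ (deriv_dimDen_ne_zero hr0)
  · obtain ⟨f, hf, hf', -⟩ := T.exists_extension hr hn hT
    exact ⟨f, fun α hα => hf' α (hα c), hf⟩
  · have h : Function.update α i (α i + 2 * r) c ∉ integers := by
      by_cases hc : c = i
      · subst hc
        rw [Function.update_self]
        exact add_period_notMem_integers (hα c)
      · rw [Function.update_of_ne hc]
        exact hα c
    rw [T.invariant_eq hr _ h, T.invariant_eq hr α (hα c), dimDen_update hr0, T.corner_add_period,
      ← zeta_sum, Finset.mul_sum, mul_left_comm]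
    simp only [mul_assoc]
  -- For a knot the section comes from the quotient with its poles in place. At a zero of `dimDen`
  -- the inverse has the value $0$, so quasi-periodicity holds at every point, and meromorphy
  -- disregards the values at the poles.
  · rcases (Nat.one_le_iff_ne_zero.2 (Fin.pos c).ne').eq_or_lt with hn | hn
    · obtain ⟨s, hs⟩ := exists_section (r := r) (C := T.linking)
        (f := fun α => (dimDen r (α c))⁻¹ * T.corner r α) fun α i => by
          rw [dimDen_update hr0, T.corner_add_period, mul_left_comm]
      refine ⟨s, fun p α hα hα' => ?_, fun _ p z hz => ?_, fun h => absurd h (by omega)⟩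
      · rw [hs p α hα, T.invariant_eq hr α (hα' c)]
      · have hopen : IsOpen {z : ℂ | (fun _ => z) ∈ (chart (r := r) (n := n) p).target} :=
          (chart p).open_target.preimage (continuous_pi fun _ => continuous_id)
        refine (hmer z).congr (Filter.EventuallyEq.filter_mono ?_ nhdsWithin_le_nhds)
        filter_upwards [hopen.mem_nhds hz] with y hy
        exact (hs p _ hy).symm
    · obtain ⟨f, hf, hf', hf''⟩ := T.exists_extension hr hn hT
      obtain ⟨s, hs⟩ := exists_section (r := r) (C := T.linking) hf''
      refine ⟨s, fun p α hα hα' => ?_, fun h => absurd h (by omega), fun _ p => ?_⟩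
      · rw [hs p α hα, hf' α (hα' c)]
      · exact hf.differentiableOn.congr (hs p)
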